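/- Let $n\ge 1$, let $C=\{x\in\mathbb{R}^n : x_i\ge 0 \text{ for all } i\}$ and let $e_1,\dots,e_n$ be the standard basis of $\mathbb{R}^n$. A polyhedron is an intersection of finitely many closed half-spaces; it is a lattice polyhedron if all its vertices lie in $\mathbb{Z}^n$. The support cone of a polyhedron $K$ is the set of linear functionals on $\mathbb{R}^n$ that are bounded below on $K$. Let $\mathcal{M}$ be the set of all pairs $(A,B)$ of polyhedra in $\mathbb{R}^n$ that both have the same support cone as $C$ and whose symmetric difference is bounded, with addition $(A,B)+(A',B')=(A+A',B+B')$ (Minkowski sums). The volume of a pair $(A,B)\in\mathcal{M}$ is $n!\,\bigl(\lambda(A\setminus B)-\lambda(B\setminus A)\bigr)$, where $\lambda$ is Lebesgue measure. The relative mixed volume is the function $\mathrm{Vol}_C:\mathcal{M}^n\to\mathbb{R}$ that is symmetric, additive in each argument, and takes at $(P,\dots,P)$ the volume of $P$, for every $P\in\mathcal{M}$. **Theorem.** The relative mixed volume exists and is unique. Let $B_1,\dots,B_n\subset\mathbb{R}^n$ be lattice polyhedra such that the symmetric difference of $C$ and $B_i$ is bounded for every $i$. Then $(C,B_i)\in\mathcal{M}$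 for every $i$, so the relative mixed volume of $(C,B_1),\dots,(C,B_n)$ is well defined, and the following are equivalent: 1. $\mathrm{Vol}_C\bigl((C,B_1),\dots,(C,B_n)\bigr)=1$; 2. none of $B_1,\dots,B_n$ contains the origin and, after reordering the polyhedra and the coordinates, $e_m\in B_m$ for every $m=1,\dots,n$; that is, there are permutations $\sigma,\tau$ of $\{1,\dots,n\}$ with $e_{\tau(m)}\in B_{\sigma(m)}$ for every $m$. -/

import Mathlib

open scoped Pointwise

namespace RelativeMixedVolume

/-- A polyhedron in `ℝⁿ`: an intersection of finitely many closed half-spaces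
`{x | c ≤ γ x}`. (A zero covector `γ` only adds the whole space or the empty set.) -/
def IsPolyhedron {n : ℕ} (K : Set (Fin n → ℝ)) : Prop :=
  ∃ s : Finset (Module.Dual ℝ (Fin n → ℝ) × ℝ), K = {x | ∀ p ∈ s, p.2 ≤ p.1 x}

/-- A lattice polyhedron: a polyhedron all of whose vertices (extreme points) lie in `ℤⁿ`. -/
def IsLatticePolyhedron {n : ℕ} (K : Set (Fin n → ℝ)) : Prop :=
  IsPolyhedron K ∧ ∀ v ∈ Set.extremePoints ℝ K, ∃ z : Fin n → ℤ, ∀ i, v i = (z i : ℝ)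

/-- The positive orthant `C` of `ℝⁿ`. -/
def orthant (n : ℕ) : Set (Fin n → ℝ) :=
  {x | ∀ i, 0 ≤ x i}

/-- The support cone of `K`: the covectors `γ` with `inf_{x ∈ K} γ x > -∞`. -/
def supportCone {n : ℕ} (K : Set (Fin n → ℝ)) : Set (Module.Dual ℝ (Fin n → ℝ)) :=
  {γ | BddBelow (γ '' K)}

/-- The set `M_Γ` of pairs of polyhedra with support cone `Γ` and bounded symmetric difference.
Pairs are added componentwise, by Minkowski addition (the instance on `Set _ × Set _`). -/
def polyhedronPairs {n : ℕ} (Γ : Set (Module.Dual ℝ (Fin n → ℝ))) :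
    Set (Set (Fin n → ℝ) × Set (Fin n → ℝ)) :=
  {P | IsPolyhedron P.1 ∧ IsPolyhedron P.2 ∧ supportCone P.1 = Γ ∧ supportCone P.2 = Γ ∧
    Bornology.IsBounded (symmDiff P.1 P.2)}

/-- The (lattice) volume of a pair `(A, B)`: the lattice volume (`n!` times Lebesgue measure)
of `A \ B` minus that of `B \ A`. -/
noncomputable def pairVolume {n : ℕ} (P : Set (Fin n → ℝ) × Set (Fin n → ℝ)) : ℝ :=
  (n.factorial : ℝ) *
    (MeasureTheory.volume.real (P.1 \ P.2) - MeasureTheory.volume.real (P.2 \ P.1))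

/-- `MV` is a mixed volume of pairs of polyhedra with support cone `Γ`: on `n`-tuples of
elements of the semigroup `M_Γ` it is symmetric, multilinear (additive in each argument), and
its value at `(P, …, P)` is the volume of the pair `P`. Values of `MV` at tuples that are not
in `M_Γ` are irrelevant. -/
structure IsMixedVolume {n : ℕ} (Γ : Set (Module.Dual ℝ (Fin n → ℝ)))
    (MV : (Fin n → Set (Fin n → ℝ) × Set (Fin n → ℝ)) → ℝ) : Prop where
  symmetric : ∀ P : Fin n → Set (Fin n → ℝ) × Set (Fin n → ℝ),
    (∀ i, P i ∈ polyhedronPairs Γ) → ∀ σ : Equiv.Perm (Fin n), MV (fun i => P (σ i)) = MV P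
  additive : ∀ P : Fin n → Set (Fin n → ℝ) × Set (Fin n → ℝ),
    (∀ i, P i ∈ polyhedronPairs Γ) → ∀ i, ∀ Q ∈ polyhedronPairs Γ, ∀ R ∈ polyhedronPairs Γ,
      MV (Function.update P i (Q + R)) =
        MV (Function.update P i Q) + MV (Function.update P i R)
  diagonal : ∀ P ∈ polyhedronPairs Γ, MV (fun _ => P) = pairVolume P

end RelativeMixedVolume

/-!
The relative mixed volume is realized as a difference of classical mixed volumes of polytopes.
A polyhedron `A` with the support cone of the orthant is an upper set, and for large `R` its
truncation `{x ∈ A | x ≤ (R, …, R)}` is a full-dimensional polytope. Truncation is additive: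
the truncation of `A + A'` at `R + R'` is the sum of the truncations at `R` and `R'`. So for pairs
whose symmetric difference lies below `R` the polarization of `pairVolume` is the mixed volume
of the first truncations minus that of the second ones (`relMixedVolume`). Uniqueness is the
polarization formula (`AdditiveOn.altSum_map_const`).

Two properties of mixed volumes of polytopes are needed: additivity and monotonicity. Both come
from the fact that the volume of a polytope is the integral over `ℝⁿ` of the Hessian determinant of
a convex potential whose gradient maps `ℝⁿ` injectively onto the polytope up to its boundary
(`IsPotential`). Potentials add up under Minkowski sums, so the mixed volume is the integral of the
mixed determinant of the Hessians. This is additive in each argument, and its integrand is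
nonnegative. As potential of the convex hull of a finite set `T` one takes
`log ∑ a ∈ T, c a * exp (a ⬝ᵥ x)` for any positive coefficients `c`. If the hull of `T` lies in the
hull of `T'`, then the coefficients `1` on `T` and `ε` on `T' \ T` give the larger polytope for every
`ε > 0` and, in the limit `ε → 0`, the Hessian of the smaller one. Fatou's lemma then yields
`mixedVolume_mono`. In particular the relative mixed volume of the pairs `(C, B i)` decreases
when the `B i` grow.

The extremal case is an explicit computation. For `0 < ε ≤ 1` let `D j` be the set of all points of
the orthant with `x j + ε * ∑ k ≠ j, x k ≥ 1`. Slicing along the first coordinate shows by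
induction on `n` that the pairs `(C, D j)` have mixed volume `1` (`relMixedVolume_spike`): adding
the first of these sets inserts slices at the levels `0 ≤ s < 1`, and by polarization with a base
point that varies with `s` each level contributes the same mixed volume in dimension `n - 1`. The
case `ε = 1` is the complement of the standard simplex.

For the classification let the `B i` be lattice polyhedra. If one of them contains the origin, it
contains the orthant, and the mixed volume is at most `0`. Otherwise each `B i` lies in the set
`∑ k, x k ≥ 1`, so the mixed volume is at least `1`. If `e (τ m) ∈ B (σ m)` for all `m`, then
`D (τ m) ⊆ B (σ m)` for small `ε`, so the mixed volume is at most `1`. If there are no such `σ` and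
`τ`, then by Hall's theorem there are sets `I` and `J` of indices with `|J| < |I|` such that
`e j ∉ B i` for all `i ∈ I` and `j ∉ J`. By integrality of the vertices, `B i` for `i ∈ I` lies in
the set `∑ k ∈ J, x k + (1 / 2) * ∑ k ∉ J, x k ≥ 1`. Doubling the coordinates in `J` and comparing
with multiples of the standard simplex shows that the mixed volume is at least `2 ^ (|I| - |J|)`,
hence not `1` (`two_pow_le_relMixedVolume`).
-/

namespace RelativeMixedVolume

/-! ### Polarization of additive functions -/

/-- `F` is additive in each argument, for arguments in `M`. -/
def AdditiveOn {X : Type*} [AddCommMonoid X] {n : ℕ} (M : Set X) (F : (Fin n → X) → ℝ) : Prop :=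
  ∀ P : Fin n → X, (∀ i, P i ∈ M) → ∀ i, ∀ Q ∈ M, ∀ R ∈ M,
    F (Function.update P i (Q + R)) = F (Function.update P i Q) + F (Function.update P i R)

/-- The alternating sum `∑ (-1)^(n - |S|) f S` over the subsets `S` of `Fin n`. -/
noncomputable def altSum {n : ℕ} (f : Finset (Fin n) → ℝ) : ℝ :=
  ∑ S : Finset (Fin n), (-1) ^ (n - S.card) * f S

lemma sum_mem_of_nonempty {X ι : Type*} [AddCommMonoid X] {M : Set X}
    (hM : ∀ a ∈ M, ∀ b ∈ M, a + b ∈ M) (q : ι → X) (hq : ∀ i, q i ∈ M)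
    {T : Finset ι} (hT : T.Nonempty) : ∑ i ∈ T, q i ∈ M := by
  classical
  induction hT using Finset.Nonempty.cons_induction with
  | singleton a => simpa using hq a
  | cons a s ha hs ih => rw [Finset.sum_cons]; exact hM _ (hq a) _ ih

lemma AdditiveOn.map_cons_sum {X ι : Type*} [AddCommMonoid X] {n : ℕ} {M : Set X}
    (hM : ∀ a ∈ M, ∀ b ∈ M, a + b ∈ M) {F : (Fin (n + 1) → X) → ℝ} (hF : AdditiveOn M F)
    (q : ι → X) (hq : ∀ i, q i ∈ M) {T : Finset ι} (hT : T.Nonempty) (v : Fin n → X)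
    (hv : ∀ i, v i ∈ M) :
    F (Fin.cons (∑ i ∈ T, q i) v) = ∑ i ∈ T, F (Fin.cons (q i) v) := by
  classical
  induction hT using Finset.Nonempty.cons_induction with
  | singleton a => simp
  | cons a s ha hs ih =>
    rw [Finset.sum_cons, Finset.sum_cons, ← ih]
    have := hF (Fin.cons (q a) v) (fun i => by
      refine Fin.cases ?_ (fun j => ?_) i
      · simpa using hq a
      · simpa using hv j) 0 (q a) (hq a) _ (sum_mem_of_nonempty hM q hq hs)
    simpa only [Fin.update_cons_zero] using this

/-- Multinomial expansion on the diagonal. The sum runs over all `φ : Fin n → ι`, the product of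
indicators selects those with values in `T`. -/
lemma AdditiveOn.map_const_sum {X ι : Type*} [AddCommMonoid X] [Fintype ι] [DecidableEq ι] {n : ℕ}
    {M : Set X} (hM : ∀ a ∈ M, ∀ b ∈ M, a + b ∈ M) {F : (Fin n → X) → ℝ} (hF : AdditiveOn M F)
    (q : ι → X) (hq : ∀ i, q i ∈ M) {T : Finset ι} (hT : T.Nonempty) :
    F (fun _ => ∑ i ∈ T, q i) =
      ∑ φ : Fin n → ι, (∏ k, if φ k ∈ T then (1 : ℝ) else 0) * F (fun k => q (φ k)) := by
  induction n with
  | zero =>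
    simp only [Finset.univ_unique, Finset.univ_eq_empty, Finset.prod_empty, one_mul,
      Finset.sum_singleton]
    exact congrArg F (Subsingleton.elim _ _)
  | succ n ih =>
    have hs := sum_mem_of_nonempty hM q hq hT
    have hF' : ∀ a ∈ M, AdditiveOn M (fun v : Fin n → X => F (Fin.cons a v)) := by
      intro a ha P hP i Q hQ R hR
      have := hF (Fin.cons a P) (fun j => by
        refine Fin.cases ?_ (fun j => ?_) j
        · simpa using ha
        · simpa using hP j) i.succ Q hQ R hR
      simpa only [Fin.cons_update] using this
    have hconst : (fun _ : Fin (n + 1) => ∑ i ∈ T, q i)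
        = Fin.cons (∑ i ∈ T, q i) (fun _ : Fin n => ∑ i ∈ T, q i) := by
      ext k
      refine Fin.cases ?_ (fun j => ?_) k <;> simp
    rw [hconst, ih (hF' _ hs), ← (Fin.consEquiv (fun _ : Fin (n + 1) => ι)).sum_comp,
      Fintype.sum_prod_type, Finset.sum_comm]
    refine Finset.sum_congr rfl fun φ _ => ?_
    rw [hF.map_cons_sum hM q hq hT _ (fun i => hq _), Finset.mul_sum,
      ← Finset.sum_filter_add_sum_filter_not Finset.univ (fun i => i ∈ T)]
    have h0 : ∀ i ∈ Finset.univ.filter (fun i => ¬ i ∈ T),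
        (∏ k, if (Fin.consEquiv (fun _ : Fin (n + 1) => ι)) (i, φ) k ∈ T then (1 : ℝ) else 0) *
          F (fun k => q ((Fin.consEquiv (fun _ : Fin (n + 1) => ι)) (i, φ) k)) = 0 := by
      intro i hi
      have : i ∉ T := by simpa using hi
      simp [Fin.prod_univ_succ, Fin.consEquiv, this]
    rw [Finset.sum_eq_zero h0, add_zero, Finset.filter_univ_mem]
    refine Finset.sum_congr rfl fun i hi => ?_
    have h2 : (fun k => q ((Fin.consEquiv (fun _ : Fin (n + 1) => ι)) (i, φ) k))
        = Fin.cons (q i) (fun k => q (φ k)) := by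
      ext k
      refine Fin.cases ?_ (fun j => ?_) k <;> simp [Fin.consEquiv]
    rw [h2]
    simp [Fin.prod_univ_succ, Fin.consEquiv, hi]

/-- Inclusion–exclusion: the alternating sum over the sets containing all values of `φ` vanishes
unless `φ` is onto. -/
lemma altSum_prod_insertNone {n : ℕ} (φ : Fin n → Option (Fin n)) :
    altSum (fun S => ∏ k, if φ k ∈ Finset.insertNone S then (1 : ℝ) else 0) =
      if ∀ i, ∃ k, φ k = some i then 1 else 0 := by
  classical
  unfold altSum
  split_ifs with h
  · rw [Finset.sum_eq_single Finset.univ]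
    · simp
    · intro S _ hS
      obtain ⟨i, hi⟩ : ∃ i, i ∉ S := by
        by_contra! hc
        exact hS (Finset.eq_univ_iff_forall.2 hc)
      obtain ⟨k, hk⟩ := h i
      beta_reduce
      rw [Finset.prod_eq_zero (Finset.mem_univ k), mul_zero]
      rw [if_neg]
      rw [hk]
      simpa using hi
    · simp
  · push Not at h
    obtain ⟨i, hi⟩ := h
    have huniv : (Finset.univ : Finset (Finset (Fin n))) =
        (insert i (Finset.univ.erase i)).powerset := by
      rw [Finset.insert_erase (Finset.mem_univ i), Finset.powerset_univ]
    rw [huniv, Finset.sum_powerset_insert (by simp), ← Finset.sum_add_distrib]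
    refine Finset.sum_eq_zero fun S hS => ?_
    have hiS : i ∉ S := fun hc => by simpa using Finset.mem_powerset.1 hS hc
    have hcard : S.card + 1 ≤ n := by
      rw [← Finset.card_insert_of_notMem hiS]
      simpa using Finset.card_le_univ (insert i S)
    have hprod : ∀ k, (φ k ∈ Finset.insertNone (insert i S)) ↔ φ k ∈ Finset.insertNone S := by
      intro k
      have hk := hi k
      cases hφ : φ k with
      | none => simp
      | some j =>
        have : j ≠ i := fun hc => hk (by rw [hφ, hc])
        simp [this]
    simp only [hprod]
    rw [Finset.card_insert_of_notMem hiS, show n - S.card = n - (S.card + 1) + 1 by omega, pow_succ]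
    ring

/-- **Polarization**: the alternating sum of the values on the diagonal at `x + ∑_{i ∈ S} p i`
recovers the symmetrization of a multi-additive function, whatever the base point `x`. -/
lemma AdditiveOn.altSum_map_const {X : Type*} [AddCommMonoid X] {n : ℕ} {M : Set X}
    (hM : ∀ a ∈ M, ∀ b ∈ M, a + b ∈ M) {F : (Fin n → X) → ℝ} (hF : AdditiveOn M F)
    {x : X} (hx : x ∈ M) (p : Fin n → X) (hp : ∀ i, p i ∈ M) :
    altSum (fun S => F (fun _ => x + ∑ i ∈ S, p i)) =
      ∑ σ : Equiv.Perm (Fin n), F (fun k => p (σ k)) := by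
  classical
  set q : Option (Fin n) → X := fun o => o.elim x p with hq
  have hqM : ∀ o, q o ∈ M := by
    intro o
    cases o with
    | none => exact hx
    | some i => exact hp i
  have h1 : ∀ S : Finset (Fin n), F (fun _ => x + ∑ i ∈ S, p i) =
      ∑ φ : Fin n → Option (Fin n), (∏ k, if φ k ∈ Finset.insertNone S then (1 : ℝ) else 0) *
        F (fun k => q (φ k)) := by
    intro S
    rw [← hF.map_const_sum hM q hqM (T := Finset.insertNone S) ⟨none, by simp⟩]
    simp [hq, Finset.insertNone]
  have h2 : altSum (fun S => F (fun _ => x + ∑ i ∈ S, p i)) =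
      ∑ φ : Fin n → Option (Fin n), (if ∀ i, ∃ k, φ k = some i then 1 else 0) *
        F (fun k => q (φ k)) := by
    simp only [← altSum_prod_insertNone, altSum, h1, Finset.mul_sum, Finset.sum_mul]
    rw [Finset.sum_comm]
    refine Finset.sum_congr rfl fun φ _ => Finset.sum_congr rfl fun S _ => ?_
    ring
  rw [h2]
  simp only [ite_mul, one_mul, zero_mul]
  rw [← Finset.sum_filter]
  symm
  refine Finset.sum_bij (fun σ _ => fun k => some (σ k)) ?_ ?_ ?_ ?_
  · intro σ _
    simp only [Finset.mem_filter, Finset.mem_univ, true_and]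
    intro i
    exact ⟨σ.symm i, by simp⟩
  · intro σ _ τ _ h
    ext k
    have := congrFun h k
    simp only [Option.some.injEq] at this
    rw [this]
  · intro φ hφ
    simp only [Finset.mem_filter, Finset.mem_univ, true_and] at hφ
    choose g hg using hφ
    have hinj : Function.Injective g := by
      intro a b hab
      have := hg a
      rw [hab, hg b] at this
      exact (Option.some.inj this).symm
    have hbij : Function.Bijective g := Finite.injective_iff_bijective.1 hinj
    refine ⟨(Equiv.ofBijective g hbij).symm, Finset.mem_univ _, ?_⟩
    ext1 k
    obtain ⟨i, rfl⟩ := hbij.2 k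
    rw [hg i]
    congr 1
    exact (Equiv.ofBijective g hbij).symm_apply_apply i
  · intro σ _
    rfl

lemma altSum_sub {n : ℕ} (f g : Finset (Fin n) → ℝ) :
    altSum (fun S => f S - g S) = altSum f - altSum g := by
  simp only [altSum, mul_sub, Finset.sum_sub_distrib]

lemma altSum_const_mul {n : ℕ} (c : ℝ) (f : Finset (Fin n) → ℝ) :
    altSum (fun S => c * f S) = c * altSum f := by
  simp only [altSum, Finset.mul_sum]
  exact Finset.sum_congr rfl fun S _ => by ring

/-- Alternating sums do not depend on the labelling of the indices. -/
lemma altSum_map_equiv {n : ℕ} (σ : Equiv.Perm (Fin n)) (f : Finset (Fin n) → ℝ) :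
    altSum (fun S => f (S.map σ.toEmbedding)) = altSum f := by
  unfold altSum
  rw [← (Equiv.finsetCongr σ).sum_comp (fun S => (-1 : ℝ) ^ (n - S.card) * f S)]
  simp

open MeasureTheory Filter Topology

variable {n : ℕ}

section

open Matrix

/-! ### Volume as an integral of a Hessian determinant -/

/-- A convex potential for the set `K`: a function `f` with gradient `F`, whose values lie in `K`,
and positive definite Hessian `H`, which grows like the support function of `K`. -/
structure IsPotential (K : Set (Fin n → ℝ)) (f : (Fin n → ℝ) → ℝ)
    (F : (Fin n → ℝ) → (Fin n → ℝ)) (H : (Fin n → ℝ) → Matrix (Fin n) (Fin n) ℝ) : Prop where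
  cont : Continuous f
  grad : ∀ x v, HasLineDerivAt ℝ f (F x ⬝ᵥ v) x v
  hess : ∀ x, HasFDerivAt F (Matrix.toLin' (H x)).toContinuousLinearMap x
  hess_cont : Continuous H
  posDef : ∀ x, (H x).PosDef
  mem : ∀ x, F x ∈ K
  lower : ∃ c : ℝ, ∀ u ∈ K, ∀ x, u ⬝ᵥ x - c ≤ f x

lemma IsPotential.add {K K' : Set (Fin n → ℝ)} {f f' : (Fin n → ℝ) → ℝ}
    {F F' : (Fin n → ℝ) → (Fin n → ℝ)} {H H' : (Fin n → ℝ) → Matrix (Fin n) (Fin n) ℝ}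
    (h : IsPotential K f F H) (h' : IsPotential K' f' F' H') :
    IsPotential (K + K') (fun x => f x + f' x) (fun x => F x + F' x) (fun x => H x + H' x) where
  cont := h.cont.add h'.cont
  grad x v := by
    rw [add_dotProduct]
    exact HasDerivAt.add (h.grad x v) (h'.grad x v)
  hess x := by
    rw [map_add, map_add]
    exact (h.hess x).add (h'.hess x)
  hess_cont := h.hess_cont.add h'.hess_cont
  posDef x := (h.posDef x).add (h'.posDef x)
  mem x := Set.add_mem_add (h.mem x) (h'.mem x)
  lower := by
    obtain ⟨c, hc⟩ := h.lower
    obtain ⟨c', hc'⟩ := h'.lower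
    refine ⟨c + c', ?_⟩
    rintro _ ⟨u, hu, u', hu', rfl⟩ x
    have h1 := hc u hu x
    have h2 := hc' u' hu' x
    simp only [add_dotProduct]
    linarith

lemma IsPotential.sum {ι : Type*} {K : ι → Set (Fin n → ℝ)} {f : ι → (Fin n → ℝ) → ℝ}
    {F : ι → (Fin n → ℝ) → (Fin n → ℝ)} {H : ι → (Fin n → ℝ) → Matrix (Fin n) (Fin n) ℝ}
    (h : ∀ i, IsPotential (K i) (f i) (F i) (H i)) {S : Finset ι} (hS : S.Nonempty) :
    IsPotential (∑ i ∈ S, K i) (fun x => ∑ i ∈ S, f i x) (fun x => ∑ i ∈ S, F i x)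
      (fun x => ∑ i ∈ S, H i x) := by
  classical
  induction hS using Finset.Nonempty.cons_induction with
  | singleton a => simpa using h a
  | cons a s ha hs ih => simpa only [Finset.sum_cons] using (h a).add ih

lemma IsPotential.injective {K : Set (Fin n → ℝ)} {f : (Fin n → ℝ) → ℝ}
    {F : (Fin n → ℝ) → (Fin n → ℝ)} {H : (Fin n → ℝ) → Matrix (Fin n) (Fin n) ℝ}
    (h : IsPotential K f F H) : Function.Injective F := by
  intro x y hxy
  by_contra hne
  set v := y - x with hv
  have hv0 : v ≠ 0 := sub_ne_zero.2 (Ne.symm hne)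
  -- the slope of `f` along the segment is strictly increasing
  have hd : ∀ t : ℝ, HasDerivAt (fun t : ℝ => F (x + t • v) ⬝ᵥ v)
      ((H (x + t • v) *ᵥ v) ⬝ᵥ v) t := by
    intro t
    have h1 : HasDerivAt (fun t : ℝ => x + t • v) v t := by
      simpa using ((hasDerivAt_id t).smul_const v).const_add x
    have h2 := (h.hess (x + t • v)).comp_hasDerivAt t h1
    have h3 : HasDerivAt (fun t : ℝ => F (x + t • v)) (H (x + t • v) *ᵥ v) t := by
      simpa [Function.comp_def] using h2
    simp only [dotProduct]
    rw [hasDerivAt_pi] at h3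
    exact HasDerivAt.fun_sum fun i _ => (h3 i).mul_const (v i)
  have hmono : StrictMono (fun t : ℝ => F (x + t • v) ⬝ᵥ v) := by
    refine strictMono_of_deriv_pos fun t => ?_
    rw [(hd t).deriv, dotProduct_comm]
    simpa using (h.posDef (x + t • v)).dotProduct_mulVec_pos hv0
  have := hmono (show (0 : ℝ) < 1 by norm_num)
  simp [hv, hxy] at this

lemma IsPotential.interior_subset_range {K : Set (Fin n → ℝ)} {f : (Fin n → ℝ) → ℝ}
    {F : (Fin n → ℝ) → (Fin n → ℝ)} {H : (Fin n → ℝ) → Matrix (Fin n) (Fin n) ℝ}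
    (h : IsPotential K f F H) : interior K ⊆ Set.range F := by
  intro z hz
  obtain ⟨c, hc⟩ := h.lower
  obtain ⟨r, hr, hball⟩ := Metric.isOpen_iff.1 isOpen_interior z hz
  have hball' : Metric.ball z r ⊆ K := hball.trans interior_subset
  have hlow : ∀ x, (r / 2) * ‖x‖ - c ≤ f x - z ⬝ᵥ x := by
    intro x
    rcases isEmpty_or_nonempty (Fin n) with hn | hn
    · have hx : x = 0 := Subsingleton.elim _ _
      have := hc z (hball' (Metric.mem_ball_self hr)) x
      simp [hx] at this ⊢
      linarith
    · obtain ⟨j, hj⟩ : ∃ j, ‖x‖ = |x j| := by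
        obtain ⟨j, hj⟩ := Finite.exists_max (fun j => ‖x j‖)
        exact ⟨j, le_antisymm ((pi_norm_le_iff_of_nonneg (norm_nonneg _)).2 hj)
          (norm_le_pi_norm x j)⟩
      -- move from `z` in the direction of the largest coordinate of `x`
      have hu : z + Pi.single j ((r / 2) * SignType.sign (x j)) ∈ K := by
        apply hball'
        rw [mem_ball_iff_norm, add_sub_cancel_left, Pi.norm_single, Real.norm_eq_abs, abs_mul,
          abs_of_pos (half_pos hr)]
        have : |((SignType.sign (x j) : SignType) : ℝ)| ≤ 1 := by
          rcases SignType.sign (x j) with _ | _ | _ <;> simp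
        nlinarith
      have h1 := hc _ hu x
      rw [add_dotProduct, single_dotProduct, mul_assoc, sign_mul_self, ← hj] at h1
      linarith
  have hcont : Continuous (fun x => f x - z ⬝ᵥ x) :=
    h.cont.sub (continuous_const.dotProduct continuous_id)
  obtain ⟨x, hx⟩ := hcont.exists_forall_le (tendsto_atTop_mono hlow
    (tendsto_atTop_add_const_right _ _
      (tendsto_norm_cocompact_atTop.const_mul_atTop (half_pos hr))))
  refine ⟨x, ?_⟩
  rw [← sub_eq_zero, ← dotProduct_eq_zero_iff]
  intro v
  have h1 : HasDerivAt (fun t : ℝ => f (x + t • v) - z ⬝ᵥ (x + t • v))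
      (F x ⬝ᵥ v - z ⬝ᵥ v) 0 := by
    refine HasDerivAt.sub (h.grad x v) ?_
    have : HasDerivAt (fun t : ℝ => z ⬝ᵥ x + t * (z ⬝ᵥ v)) (z ⬝ᵥ v) 0 := by
      simpa using ((hasDerivAt_id (0 : ℝ)).mul_const (z ⬝ᵥ v)).const_add (z ⬝ᵥ x)
    simpa [dotProduct_add, dotProduct_smul] using this
  have hmin : IsLocalMin (fun t : ℝ => f (x + t • v) - z ⬝ᵥ (x + t • v)) 0 :=
    Eventually.of_forall fun t => by simpa using hx (x + t • v)
  rw [sub_dotProduct]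
  exact hmin.hasDerivAt_eq_zero h1

/-- The volume of a convex set is the integral of the Hessian determinant of a potential: the
gradient maps space bijectively onto a set between the interior of `K` and `K`. -/
lemma IsPotential.lintegral_det {K : Set (Fin n → ℝ)} {f : (Fin n → ℝ) → ℝ}
    {F : (Fin n → ℝ) → (Fin n → ℝ)} {H : (Fin n → ℝ) → Matrix (Fin n) (Fin n) ℝ}
    (h : IsPotential K f F H) (hK : Convex ℝ K) :
    ∫⁻ x, ENNReal.ofReal (H x).det = volume K := by
  have h1 := lintegral_abs_det_fderiv_eq_addHaar_image volume MeasurableSet.univ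
    (fun x _ => (h.hess x).hasFDerivWithinAt) h.injective.injOn
  rw [Measure.restrict_univ, Set.image_univ] at h1
  have h2 : volume (Set.range F) = volume K := by
    refine le_antisymm (measure_mono (Set.range_subset_iff.2 h.mem)) ?_
    have h3 : volume K ≤ volume (interior K) := by
      calc volume K ≤ volume (interior K ∪ frontier K) := measure_mono (by
            rw [← closure_eq_interior_union_frontier]; exact subset_closure)
        _ ≤ volume (interior K) + volume (frontier K) := measure_union_le _ _
        _ = volume (interior K) := by rw [hK.addHaar_frontier volume, add_zero]
    exact h3.trans (measure_mono h.interior_subset_range)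
  rw [← h2, ← h1]
  refine lintegral_congr fun x => ?_
  have hp := (h.posDef x).det_pos
  simp only [ContinuousLinearMap.det, LinearMap.coe_toContinuousLinearMap, LinearMap.det_toLin']
  rw [abs_of_pos hp]

/-! ### Mixed determinants and mixed volumes of convex bodies -/

/-- The mixed determinant (polarization of `n! det`): row `k` is taken from the matrix
`A (σ k)`, and one sums over all `σ`. -/
noncomputable def mixedDet (A : Fin n → Matrix (Fin n) (Fin n) ℝ) : ℝ :=
  ∑ σ : Equiv.Perm (Fin n), (Matrix.of fun k j => A (σ k) k j).det

lemma additiveOn_det_rows :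
    AdditiveOn Set.univ (fun A : Fin n → Matrix (Fin n) (Fin n) ℝ =>
      (Matrix.of fun k j => A k k j).det) := by
  intro P _ i Q _ R _
  have h : ∀ Q : Matrix (Fin n) (Fin n) ℝ,
      (Matrix.of fun k j => Function.update P i Q k k j) =
        (Matrix.of fun k j => P k k j).updateRow i (Q i) := by
    intro Q
    ext k j
    by_cases hk : k = i
    · subst hk; simp
    · simp [hk]
  simp only [h]
  exact det_updateRow_add _ _ _ _

lemma altSum_det (A : Fin n → Matrix (Fin n) (Fin n) ℝ) :
    altSum (fun S => (∑ i ∈ S, A i).det) = mixedDet A := by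
  have := additiveOn_det_rows.altSum_map_const (M := Set.univ) (by simp)
    (Set.mem_univ (0 : Matrix (Fin n) (Fin n) ℝ)) A (by simp)
  simp only [zero_add] at this
  exact this

lemma mixedDet_const (A : Matrix (Fin n) (Fin n) ℝ) :
    mixedDet (fun _ => A) = n.factorial * A.det := by
  simp only [mixedDet, Finset.sum_const, nsmul_eq_mul, Finset.card_univ, Fintype.card_perm,
    Fintype.card_fin]
  rfl

lemma mixedDet_update_add (A : Fin n → Matrix (Fin n) (Fin n) ℝ) (i : Fin n)
    (Q R : Matrix (Fin n) (Fin n) ℝ) :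
    mixedDet (Function.update A i (Q + R)) =
      mixedDet (Function.update A i Q) + mixedDet (Function.update A i R) := by
  simp only [mixedDet, ← Finset.sum_add_distrib]
  refine Finset.sum_congr rfl fun σ _ => ?_
  have h : ∀ Q, (fun k => Function.update A i Q (σ k)) =
      Function.update (fun k => A (σ k)) (σ.symm i) Q := by
    intro Q
    exact Function.update_comp_equiv A σ i Q
  have := additiveOn_det_rows (fun k => A (σ k)) (by simp) (σ.symm i) Q trivial R trivial
  simpa only [← h] using this

/-- Writing the matrices as sums of rank-one matrices `v vᵀ`, the mixed determinant becomes a sum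
of squares of determinants. -/
lemma mixedDet_nonneg {A : Fin n → Matrix (Fin n) (Fin n) ℝ} (hA : ∀ i, (A i).PosSemidef) :
    0 ≤ mixedDet A := by
  have h := fun i => Matrix.posSemidef_iff_eq_sum_vecMulVec.1 (hA i)
  choose m v hv using h
  have hent : ∀ i k j, A i k j = ∑ b, v i b k * v i b j := by
    intro i k j
    rw [hv i, Matrix.sum_apply]
    simp [vecMulVec_apply]
  have hdet : ∀ σ : Equiv.Perm (Fin n), (Matrix.of fun k j => A (σ k) k j).det =
      ∑ b : (∀ i, Fin (m i)), (∏ k, v (σ k) (b (σ k)) k) *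
        (Equiv.Perm.sign σ * (Matrix.of fun k j => v k (b k) j).det) := by
    intro σ
    have h1 : (Matrix.of fun k j => A (σ k) k j).det =
        ∑ b : (∀ k, Fin (m (σ k))), (∏ k, v (σ k) (b k) k) *
          (Matrix.of fun k j => v (σ k) (b k) j).det := by
      have h2 : (Matrix.of fun k j => A (σ k) k j) =
          fun k => ∑ b : Fin (m (σ k)), v (σ k) b k • v (σ k) b := by
        ext k j
        simp [hent, Finset.sum_apply]
      rw [h2]
      have h3 := (detRowAlternating (n := Fin n) (R := ℝ)).toMultilinearMap.map_sum
        (fun k (b : Fin (m (σ k))) => v (σ k) b k • v (σ k) b)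
      refine h3.trans (Finset.sum_congr rfl fun b _ => ?_)
      have h4 := (detRowAlternating (n := Fin n) (R := ℝ)).toMultilinearMap.map_smul_univ
        (fun k => v (σ k) (b k) k) (fun k => v (σ k) (b k))
      exact h4
    rw [h1]
    symm
    refine Fintype.sum_equiv (Equiv.piCongrLeft' (fun i => Fin (m i)) σ.symm) _ _ fun b => ?_
    congr 1
    rw [← det_permute]
    rfl
  have hsum : mixedDet A = ∑ b : (∀ i, Fin (m i)), (Matrix.of fun k j => v k (b k) j).det ^ 2 := by
    unfold mixedDet
    simp only [hdet]
    rw [Finset.sum_comm]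
    refine Finset.sum_congr rfl fun b _ => ?_
    rw [sq]
    nth_rw 2 [det_apply']
    rw [Finset.sum_mul]
    refine Finset.sum_congr rfl fun σ _ => ?_
    simp only [of_apply]
    ring
  rw [hsum]
  exact Finset.sum_nonneg fun b _ => sq_nonneg _

/-- The mixed volume, normalized such that `mixedVolume (fun _ => K) = n! vol K`. -/
noncomputable def mixedVolume (K : Fin n → Set (Fin n → ℝ)) : ℝ :=
  altSum (fun S => volume.real (∑ i ∈ S, K i))

/-- Bounded convex sets that have a potential. -/
def IsBody (K : Set (Fin n → ℝ)) : Prop :=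
  Convex ℝ K ∧ Bornology.IsBounded K ∧ ∃ f F H, IsPotential K f F H

lemma IsPotential.integral_det {K : Set (Fin n → ℝ)} {f : (Fin n → ℝ) → ℝ}
    {F : (Fin n → ℝ) → (Fin n → ℝ)} {H : (Fin n → ℝ) → Matrix (Fin n) (Fin n) ℝ}
    (h : IsPotential K f F H) (hK : Convex ℝ K) (hb : Bornology.IsBounded K) :
    Integrable (fun x => (H x).det) ∧ ∫ x, (H x).det = volume.real K := by
  have hm : AEStronglyMeasurable (fun x => (H x).det) volume :=
    h.hess_cont.matrix_det.aestronglyMeasurable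
  have h0 : 0 ≤ᵐ[volume] (fun x => (H x).det) :=
    Eventually.of_forall fun x => (h.posDef x).det_pos.le
  have hl := h.lintegral_det hK
  constructor
  · rw [← lintegral_ofReal_ne_top_iff_integrable hm h0, hl]
    exact hb.measure_lt_top.ne
  · rw [integral_eq_lintegral_of_nonneg_ae h0 hm, hl]
    rfl

/-- Minkowski's theorem in integral form. -/
lemma mixedVolume_eq_integral (hn : 0 < n) {K : Fin n → Set (Fin n → ℝ)}
    (hK : ∀ i, Convex ℝ (K i)) (hb : ∀ i, Bornology.IsBounded (K i))
    {f : Fin n → (Fin n → ℝ) → ℝ} {F : Fin n → (Fin n → ℝ) → (Fin n → ℝ)}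
    {H : Fin n → (Fin n → ℝ) → Matrix (Fin n) (Fin n) ℝ}
    (h : ∀ i, IsPotential (K i) (f i) (F i) (H i)) :
    Integrable (fun x => mixedDet (fun i => H i x)) ∧
      mixedVolume K = ∫ x, mixedDet (fun i => H i x) := by
  have hS : ∀ S : Finset (Fin n), Integrable (fun x => (∑ i ∈ S, H i x).det) ∧
      ∫ x, (∑ i ∈ S, H i x).det = volume.real (∑ i ∈ S, K i) := by
    intro S
    rcases S.eq_empty_or_nonempty with rfl | hS
    · have : Nonempty (Fin n) := ⟨⟨0, hn⟩⟩
      have h0 : volume ({0} : Set (Fin n → ℝ)) = 0 := measure_singleton 0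
      simp only [Finset.sum_empty, det_zero, integral_zero]
      refine ⟨integrable_zero _ _ _, ?_⟩
      simp [Measure.real, ← Set.singleton_zero]
    · have hc : Convex ℝ (∑ i ∈ S, K i) ∧ Bornology.IsBounded (∑ i ∈ S, K i) := by
        classical
        clear h
        induction hS using Finset.Nonempty.cons_induction with
        | singleton a =>
          rw [Finset.sum_singleton]
          exact ⟨hK a, hb a⟩
        | cons a s ha hs ih =>
          rw [Finset.sum_cons]
          exact ⟨(hK a).add ih.1, Bornology.IsBounded.add (hb a) ih.2⟩
      exact (IsPotential.sum h hS).integral_det hc.1 hc.2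
  simp only [← altSum_det]
  constructor
  · exact integrable_finsetSum _ fun S _ => (hS S).1.const_mul _
  · unfold mixedVolume altSum
    rw [integral_finsetSum _ fun S _ => (hS S).1.const_mul _]
    refine Finset.sum_congr rfl fun S _ => ?_
    rw [integral_const_mul, (hS S).2]

lemma mixedVolume_const (hn : 0 < n) {K : Set (Fin n → ℝ)} (hK : IsBody K) :
    mixedVolume (fun _ => K) = n.factorial * volume.real K := by
  obtain ⟨h1, h2, f, F, H, h3⟩ := hK
  rw [(mixedVolume_eq_integral hn (fun _ => h1) (fun _ => h2) (fun _ => h3)).2]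
  simp only [mixedDet_const]
  rw [integral_const_mul, (h3.integral_det h1 h2).2]

lemma mixedVolume_update_add (hn : 0 < n) {K : Fin n → Set (Fin n → ℝ)}
    (hK : ∀ i, IsBody (K i)) (i : Fin n) {Q R : Set (Fin n → ℝ)} (hQ : IsBody Q)
    (hR : IsBody R) :
    mixedVolume (Function.update K i (Q + R)) =
      mixedVolume (Function.update K i Q) + mixedVolume (Function.update K i R) := by
  have key : ∀ {L : Set (Fin n → ℝ)} {g G D}, Convex ℝ L → Bornology.IsBounded L →
      IsPotential L g G D → ∀ {f : Fin n → (Fin n → ℝ) → ℝ}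
      {F : Fin n → (Fin n → ℝ) → (Fin n → ℝ)} {H : Fin n → (Fin n → ℝ) → Matrix (Fin n) (Fin n) ℝ},
      (∀ i, IsPotential (K i) (f i) (F i) (H i)) →
      Integrable (fun x => mixedDet (Function.update (fun j => H j x) i (D x))) ∧
      mixedVolume (Function.update K i L) =
        ∫ x, mixedDet (Function.update (fun j => H j x) i (D x)) := by
    intro L g G D hL hL' h f F H hf
    have hu : ∀ x, (fun j => Function.update H i D j x) =
        Function.update (fun j => H j x) i (D x) := by
      intro x
      ext1 j
      by_cases hj : j = i
      · subst hj; simp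
      · simp [hj]
    simp only [← hu]
    refine mixedVolume_eq_integral hn (K := Function.update K i L) (f := Function.update f i g)
      (F := Function.update F i G) (H := Function.update H i D) ?_ ?_ ?_
    all_goals
      intro j
      by_cases hj : j = i
    · subst hj; simpa
    · simpa [hj] using (hK j).1
    · subst hj; simpa
    · simpa [hj] using (hK j).2.1
    · subst hj; simpa
    · simpa [hj] using hf j
  choose f F H hf using fun i => (hK i).2.2
  obtain ⟨h1, h2, g, G, D, h3⟩ := hQ
  obtain ⟨h1', h2', g', G', D', h3'⟩ := hR
  have hA := key h1 h2 h3 hf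
  have hB := key h1' h2' h3' hf
  rw [(key (h1.add h1') (h2.add h2') (h3.add h3') hf).2, hA.2, hB.2,
    ← integral_add hA.1 hB.1]
  simp only [mixedDet_update_add]

/-! ### The log-sum-exp potential of a polytope -/

/-- The exponential sum with exponents in `T` and coefficients `c`. -/
noncomputable def expSum (T : Finset (Fin n → ℝ)) (c : (Fin n → ℝ) → ℝ) (x : Fin n → ℝ) : ℝ :=
  ∑ a ∈ T, c a * Real.exp (a ⬝ᵥ x)

/-- The gradient of `log (expSum T c)`: the mean of the exponents under the Gibbs weights. -/
noncomputable def gibbsMean (T : Finset (Fin n → ℝ)) (c : (Fin n → ℝ) → ℝ) (x : Fin n → ℝ) :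
    Fin n → ℝ :=
  fun i => expSum T (fun a => c a * a i) x / expSum T c x

/-- The Hessian of `log (expSum T c)`: the covariance of the exponents under the Gibbs weights. -/
noncomputable def gibbsCov (T : Finset (Fin n → ℝ)) (c : (Fin n → ℝ) → ℝ) (x : Fin n → ℝ) :
    Matrix (Fin n) (Fin n) ℝ :=
  Matrix.of fun i j => expSum T (fun a => c a * a i * a j) x / expSum T c x -
    gibbsMean T c x i * gibbsMean T c x j

/-- The functional `x ↦ a ⬝ᵥ x`, as a continuous linear map. -/
noncomputable def dotCLM (a : Fin n → ℝ) : (Fin n → ℝ) →L[ℝ] ℝ :=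
  ∑ j, a j • ContinuousLinearMap.proj j

@[simp] lemma dotCLM_apply (a x : Fin n → ℝ) : dotCLM a x = a ⬝ᵥ x := by
  simp [dotCLM, dotProduct]

lemma hasFDerivAt_expSum (T : Finset (Fin n → ℝ)) (c : (Fin n → ℝ) → ℝ) (x : Fin n → ℝ) :
    HasFDerivAt (expSum T c) (dotCLM fun j => expSum T (fun a => c a * a j) x) x := by
  have h : ∀ a ∈ T, HasFDerivAt (fun x => c a * Real.exp (a ⬝ᵥ x))
      (c a • (Real.exp (a ⬝ᵥ x) • dotCLM a)) x := by
    intro a _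
    have h1 : HasFDerivAt (fun x : Fin n → ℝ => a ⬝ᵥ x) (dotCLM a) x :=
      (dotCLM a).hasFDerivAt.congr_of_eventuallyEq
        (Eventually.of_forall fun y => (dotCLM_apply a y).symm)
    exact h1.exp.const_mul (c a)
  refine (HasFDerivAt.fun_sum h).congr_fderiv ?_
  ext v
  simp only [_root_.sum_apply, _root_.smul_apply, dotCLM_apply, smul_eq_mul, expSum,
    dotProduct, Finset.sum_mul]
  rw [Finset.sum_comm]
  simp only [Finset.mul_sum]
  refine Finset.sum_congr rfl fun a _ => Finset.sum_congr rfl fun j _ => ?_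
  ring

lemma continuous_expSum (T : Finset (Fin n → ℝ)) (c : (Fin n → ℝ) → ℝ) :
    Continuous (expSum T c) :=
  continuous_iff_continuousAt.2 fun x => (hasFDerivAt_expSum T c x).continuousAt

lemma expSum_pos {T : Finset (Fin n → ℝ)} (hT : T.Nonempty) {c : (Fin n → ℝ) → ℝ}
    (hc : ∀ a ∈ T, 0 < c a) (x : Fin n → ℝ) : 0 < expSum T c x :=
  Finset.sum_pos (fun a ha => mul_pos (hc a ha) (Real.exp_pos _)) hT

lemma hasFDerivAt_gibbsMean {T : Finset (Fin n → ℝ)} (hT : T.Nonempty) {c : (Fin n → ℝ) → ℝ}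
    (hc : ∀ a ∈ T, 0 < c a) (x : Fin n → ℝ) :
    HasFDerivAt (gibbsMean T c) (Matrix.toLin' (gibbsCov T c x)).toContinuousLinearMap x := by
  rw [hasFDerivAt_pi']
  intro i
  have hZ := (expSum_pos hT hc x).ne'
  have h := (hasFDerivAt_expSum T (fun a => c a * a i) x).mul
    ((hasDerivAt_inv hZ).comp_hasFDerivAt x (hasFDerivAt_expSum T c x))
  have h' : HasFDerivAt (fun x => gibbsMean T c x i) _ x := h
  refine h'.congr_fderiv ?_
  ext v
  simp only [_root_.add_apply, _root_.smul_apply, dotCLM_apply, smul_eq_mul, Function.comp_apply,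
    ContinuousLinearMap.comp_apply, ContinuousLinearMap.proj_apply,
    LinearMap.coe_toContinuousLinearMap', toLin'_apply, mulVec, gibbsCov, gibbsMean,
    dotProduct, of_apply]
  simp only [Finset.mul_sum, ← Finset.sum_add_distrib]
  refine Finset.sum_congr rfl fun j _ => ?_
  field_simp
  ring

lemma gibbsCov_quadratic {T : Finset (Fin n → ℝ)} (hT : T.Nonempty) {c : (Fin n → ℝ) → ℝ}
    (hc : ∀ a ∈ T, 0 < c a) (x v : Fin n → ℝ) :
    v ⬝ᵥ (gibbsCov T c x *ᵥ v) =
      ∑ a ∈ T, c a * Real.exp (a ⬝ᵥ x) / expSum T c x * (a ⬝ᵥ v - gibbsMean T c x ⬝ᵥ v) ^ 2 := by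
  have hZ := (expSum_pos hT hc x).ne'
  set Z := expSum T c x with hZdef
  set m := gibbsMean T c x with hm
  have hp : ∑ a ∈ T, c a * Real.exp (a ⬝ᵥ x) / Z = 1 := by
    rw [← Finset.sum_div]; exact div_self hZ
  have hmean : ∑ a ∈ T, c a * Real.exp (a ⬝ᵥ x) / Z * (a ⬝ᵥ v) = m ⬝ᵥ v := by
    have hmi : ∀ i, m i = ∑ a ∈ T, c a * a i * Real.exp (a ⬝ᵥ x) / Z := by
      intro i
      rw [← Finset.sum_div]
      rfl
    simp only [dotProduct, hmi, Finset.sum_mul, Finset.mul_sum]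
    rw [Finset.sum_comm]
    refine Finset.sum_congr rfl fun a _ => Finset.sum_congr rfl fun j _ => ?_
    ring
  have hsq : v ⬝ᵥ (gibbsCov T c x *ᵥ v) =
      ∑ a ∈ T, c a * Real.exp (a ⬝ᵥ x) / Z * (a ⬝ᵥ v) ^ 2 - (m ⬝ᵥ v) ^ 2 := by
    have h1 : v ⬝ᵥ (gibbsCov T c x *ᵥ v) = ∑ i, ∑ j, v i * v j *
        (expSum T (fun a => c a * a i * a j) x / Z) - ∑ i, ∑ j, v i * v j * (m i * m j) := by
      simp only [dotProduct, mulVec, gibbsCov, of_apply, ← hm, ← hZdef, Finset.mul_sum,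
        ← Finset.sum_sub_distrib]
      refine Finset.sum_congr rfl fun i _ => Finset.sum_congr rfl fun j _ => ?_
      ring
    rw [h1]
    congr 1
    · simp only [expSum, Finset.sum_div, Finset.mul_sum, sq, dotProduct, Finset.sum_mul]
      rw [Finset.sum_congr rfl fun i _ => Finset.sum_comm, Finset.sum_comm]
      refine Finset.sum_congr rfl fun a _ => Finset.sum_congr rfl fun i _ =>
        Finset.sum_congr rfl fun j _ => ?_
      ring
    · simp only [sq, dotProduct, Finset.sum_mul, Finset.mul_sum]
      refine Finset.sum_congr rfl fun i _ => Finset.sum_congr rfl fun j _ => ?_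
      ring
  rw [hsq]
  have h2 : ∀ a ∈ T, c a * Real.exp (a ⬝ᵥ x) / Z * (a ⬝ᵥ v - m ⬝ᵥ v) ^ 2 =
      c a * Real.exp (a ⬝ᵥ x) / Z * (a ⬝ᵥ v) ^ 2 -
      2 * (m ⬝ᵥ v) * (c a * Real.exp (a ⬝ᵥ x) / Z * (a ⬝ᵥ v)) +
      (m ⬝ᵥ v) ^ 2 * (c a * Real.exp (a ⬝ᵥ x) / Z) := fun a _ => by ring
  rw [Finset.sum_congr rfl h2, Finset.sum_add_distrib, Finset.sum_sub_distrib,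
    ← Finset.mul_sum, ← Finset.mul_sum, hp, hmean]
  ring

lemma gibbsCov_posDef {T : Finset (Fin n → ℝ)} (hT : T.Nonempty) {c : (Fin n → ℝ) → ℝ}
    (hc : ∀ a ∈ T, 0 < c a) (hint : (interior (convexHull ℝ (T : Set (Fin n → ℝ)))).Nonempty)
    (x : Fin n → ℝ) : (gibbsCov T c x).PosDef := by
  refine PosDef.of_dotProduct_mulVec_pos ?_ ?_
  · ext i j
    simp only [gibbsCov, conjTranspose_apply, of_apply, star_trivial]
    rw [mul_comm (gibbsMean T c x j)]
    congr 3
    ext a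
    ring
  · intro v hv
    rw [star_trivial, gibbsCov_quadratic hT hc]
    have hpos : ∀ a ∈ T, 0 < c a * Real.exp (a ⬝ᵥ x) / expSum T c x := fun a ha =>
      div_pos (mul_pos (hc a ha) (Real.exp_pos _)) (expSum_pos hT hc x)
    refine lt_of_le_of_ne
      (Finset.sum_nonneg fun a ha => mul_nonneg (hpos a ha).le (sq_nonneg _)) (Ne.symm fun h0 => ?_)
    rw [Finset.sum_eq_zero_iff_of_nonneg
      (fun a ha => mul_nonneg (hpos a ha).le (sq_nonneg _))] at h0
    have hT' : (T : Set (Fin n → ℝ)) ⊆ {u | dotCLM v u = gibbsMean T c x ⬝ᵥ v} := by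
      intro a ha
      have := (mul_eq_zero.1 (h0 a ha)).resolve_left (hpos a ha).ne'
      have h3 := sub_eq_zero.1 (pow_eq_zero_iff (two_ne_zero) |>.1 this)
      simp only [Set.mem_ofPred_eq, dotCLM_apply]
      rw [dotProduct_comm, h3]
    have hconv : convexHull ℝ (T : Set (Fin n → ℝ)) ⊆
        {u | dotCLM v u = gibbsMean T c x ⬝ᵥ v} :=
      convexHull_min hT' (convex_hyperplane (dotCLM v).isLinear _)
    -- a hyperplane has no interior: move from an interior point in the direction `v`
    obtain ⟨z, hz⟩ := hint
    have hcont : Tendsto (fun t : ℝ => z + t • v) (𝓝[≠] 0) (𝓝 z) := by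
      have : Continuous (fun t : ℝ => z + t • v) := by fun_prop
      simpa using (this.tendsto 0).mono_left nhdsWithin_le_nhds
    have hev := hcont.eventually (mem_interior_iff_mem_nhds.1 hz)
    obtain ⟨t, ht, ht0⟩ := (hev.and self_mem_nhdsWithin).exists
    have h1 := hconv ht
    have h2 := hconv (interior_subset hz)
    simp only [Set.mem_ofPred_eq, map_add, map_smul, smul_eq_mul] at h1 h2
    rw [h2, add_eq_left, mul_eq_zero, dotCLM_apply, dotProduct_self_eq_zero] at h1
    exact h1.elim ht0 hv

lemma isPotential_log_expSum {T : Finset (Fin n → ℝ)} {c : (Fin n → ℝ) → ℝ}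
    (hc : ∀ a ∈ T, 0 < c a) (hint : (interior (convexHull ℝ (T : Set (Fin n → ℝ)))).Nonempty) :
    IsPotential (convexHull ℝ (T : Set (Fin n → ℝ))) (fun x => Real.log (expSum T c x))
      (gibbsMean T c) (gibbsCov T c) := by
  have hT : T.Nonempty := by
    rw [← Finset.coe_nonempty, ← convexHull_nonempty_iff (𝕜 := ℝ)]
    exact hint.mono interior_subset
  have hZ := fun x => expSum_pos hT hc x
  refine ⟨?_, ?_, hasFDerivAt_gibbsMean hT hc, ?_, gibbsCov_posDef hT hc hint, ?_, ?_⟩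
  · exact (continuous_expSum T c).log fun x => (hZ x).ne'
  · intro x v
    have := ((hasFDerivAt_expSum T c x).log (hZ x).ne').hasLineDerivAt v
    convert! this using 1
    simp only [gibbsMean, dotProduct, _root_.smul_apply, dotCLM_apply, smul_eq_mul,
      Finset.mul_sum]
    refine Finset.sum_congr rfl fun i _ => ?_
    ring
  · have hm : ∀ i, Continuous (fun x => gibbsMean T c x i) := fun i =>
      (continuous_expSum _ _).div (continuous_expSum _ _) fun x => (hZ x).ne'
    refine continuous_matrix fun i j => ?_
    exact ((continuous_expSum _ _).div (continuous_expSum _ _) fun x => (hZ x).ne').sub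
      ((hm i).mul (hm j))
  · intro x
    have : gibbsMean T c x = ∑ a ∈ T, (c a * Real.exp (a ⬝ᵥ x) / expSum T c x) • a := by
      ext i
      simp only [gibbsMean, Finset.sum_apply, Pi.smul_apply, smul_eq_mul]
      rw [expSum, Finset.sum_div]
      refine Finset.sum_congr rfl fun a _ => ?_
      ring
    rw [this]
    refine (convex_convexHull ℝ _).sum_mem (fun a ha => ?_) ?_
      (fun a ha => subset_convexHull ℝ _ ha)
    · exact (div_pos (mul_pos (hc a ha) (Real.exp_pos _)) (hZ x)).le
    · rw [← Finset.sum_div]; exact div_self (hZ x).ne'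
  · refine ⟨∑ a ∈ T, |Real.log (c a)|, fun u hu x => ?_⟩
    obtain ⟨a, ha, hau⟩ := ((dotCLM x).toLinearMap.convexOn
      (convex_univ)).exists_ge_of_mem_convexHull (Set.subset_univ _) hu
    have hau : dotCLM x u ≤ dotCLM x a := hau
    rw [dotCLM_apply, dotCLM_apply, dotProduct_comm x u, dotProduct_comm x a] at hau
    have h1 : Real.log (c a) + a ⬝ᵥ x ≤ Real.log (expSum T c x) := by
      rw [← Real.log_exp (a ⬝ᵥ x), ← Real.log_mul (hc a ha).ne' (Real.exp_pos _).ne']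
      refine Real.log_le_log (mul_pos (hc a ha) (Real.exp_pos _)) ?_
      exact Finset.single_le_sum (f := fun a => c a * Real.exp (a ⬝ᵥ x))
        (fun b hb => (mul_pos (hc b hb) (Real.exp_pos _)).le) ha
    have h2 : -|Real.log (c a)| ≤ Real.log (c a) := neg_abs_le _
    have h3 : |Real.log (c a)| ≤ ∑ a ∈ T, |Real.log (c a)| :=
      Finset.single_le_sum (f := fun a => |Real.log (c a)|) (fun b _ => abs_nonneg _) ha
    linarith

/-- Full-dimensional polytopes. -/
def IsFullPolytope (K : Set (Fin n → ℝ)) : Prop :=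
  (∃ T : Finset (Fin n → ℝ), K = convexHull ℝ (T : Set (Fin n → ℝ))) ∧ (interior K).Nonempty

lemma isBounded_convexHull_finset (T : Finset (Fin n → ℝ)) :
    Bornology.IsBounded (convexHull ℝ (T : Set (Fin n → ℝ))) :=
  isBounded_convexHull.2 T.finite_toSet.isBounded

lemma IsFullPolytope.isBody {K : Set (Fin n → ℝ)} (hK : IsFullPolytope K) : IsBody K := by
  obtain ⟨⟨T, rfl⟩, hint⟩ := hK
  exact ⟨convex_convexHull ℝ _, isBounded_convexHull_finset T, _, _, _,
    isPotential_log_expSum (c := fun _ => 1) (fun _ _ => one_pos) hint⟩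

/-- **Monotonicity of mixed volumes.** Span the larger bodies by the exponents of the
smaller ones, with coefficient `1`, and further exponents, with coefficient `ε`: for `ε > 0` the integral of the mixed determinant is the mixed volume of the larger
bodies, at `ε = 0` it is that of the smaller ones, and Fatou's lemma compares the two. -/
lemma mixedVolume_mono (hn : 0 < n) {K L : Fin n → Set (Fin n → ℝ)}
    (hK : ∀ i, IsFullPolytope (K i)) (hL : ∀ i, IsFullPolytope (L i)) (h : ∀ i, K i ⊆ L i) :
    mixedVolume K ≤ mixedVolume L := by
  classical
  choose t ht using fun i => (hK i).1
  choose t' ht' using fun i => (hL i).1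
  set T : Fin n → Finset (Fin n → ℝ) := fun i => t i ∪ t' i with hT
  have hTL : ∀ i, L i = convexHull ℝ (T i : Set (Fin n → ℝ)) := by
    intro i
    refine subset_antisymm ?_ (convexHull_min ?_ ?_)
    · rw [ht' i]
      exact convexHull_mono (by simp [hT])
    · rw [hT, Finset.coe_union]
      refine Set.union_subset ?_ ?_
      · exact (subset_convexHull ℝ _).trans ((ht i).symm.subset.trans (h i))
      · rw [ht' i]; exact subset_convexHull ℝ _
    · rw [ht' i]; exact convex_convexHull ℝ _
  set c : ℝ → Fin n → (Fin n → ℝ) → ℝ := fun ε i a => if a ∈ t i then 1 else ε with hc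
  have hpotK : ∀ i, IsPotential (K i) _ _ (gibbsCov (t i) (fun _ => 1)) := fun i => by
    have := hK i
    rw [ht i] at this ⊢
    exact isPotential_log_expSum (fun _ _ => one_pos) this.2
  have hpotL : ∀ ε > 0, ∀ i, IsPotential (L i) _ _ (gibbsCov (T i) (c ε i)) := fun ε hε i => by
    have := hL i
    rw [hTL i] at this ⊢
    refine isPotential_log_expSum (fun a _ => ?_) this.2
    simp only [hc]
    split_ifs
    · exact one_pos
    · exact hε
  have hA := mixedVolume_eq_integral hn (fun i => (hK i).isBody.1) (fun i => (hK i).isBody.2.1) hpotK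
  have hB := fun ε hε => mixedVolume_eq_integral hn (fun i => (hL i).isBody.1)
    (fun i => (hL i).isBody.2.1) (hpotL ε hε)
  have hexp : ∀ i (g : (Fin n → ℝ) → ℝ) x, Tendsto (fun ε => expSum (T i) (fun a => c ε i a * g a) x)
      (𝓝 0) (𝓝 (expSum (t i) (fun a => 1 * g a) x)) := by
    intro i g x
    have h0 : expSum (t i) (fun a => 1 * g a) x = expSum (T i) (fun a => c 0 i a * g a) x := by
      unfold expSum
      rw [← Finset.sum_subset (Finset.subset_union_left : t i ⊆ T i)]
      · refine Finset.sum_congr rfl fun a ha => ?_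
        simp [hc, ha]
      · intro a _ ha
        simp [hc, ha]
    rw [h0]
    have : Continuous (fun ε => expSum (T i) (fun a => c ε i a * g a) x) := by
      unfold expSum
      refine continuous_finsetSum _ fun a _ => ?_
      simp only [hc]
      split_ifs <;> fun_prop
    exact this.tendsto 0
  have hcov : ∀ i x, Tendsto (fun ε => gibbsCov (T i) (c ε i) x) (𝓝 0)
      (𝓝 (gibbsCov (t i) (fun _ => 1) x)) := by
    intro i x
    have hpos : expSum (t i) (fun _ => 1) x ≠ 0 := by
      refine (expSum_pos ?_ (fun _ _ => one_pos) x).ne'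
      rw [← Finset.coe_nonempty, ← convexHull_nonempty_iff (𝕜 := ℝ), ← ht i]
      exact (hK i).2.mono interior_subset
    have hZ := hexp i (fun _ => 1) x
    simp only [mul_one] at hZ
    have hm : ∀ j, Tendsto (fun ε => gibbsMean (T i) (c ε i) x j) (𝓝 0)
        (𝓝 (gibbsMean (t i) (fun _ => 1) x j)) := fun j => (hexp i (fun a => a j) x).div hZ hpos
    refine tendsto_pi_nhds.2 fun j => tendsto_pi_nhds.2 fun k => ?_
    have := hexp i (fun a => a j * a k) x
    simp only [← mul_assoc] at this
    exact (this.div hZ hpos).sub ((hm j).mul (hm k))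
  have hmixed : ∀ x, Tendsto (fun ε => mixedDet (fun i => gibbsCov (T i) (c ε i) x)) (𝓝 0)
      (𝓝 (mixedDet (fun i => gibbsCov (t i) (fun _ => 1) x))) := by
    intro x
    have hcont : Continuous (mixedDet (n := n)) := by
      unfold mixedDet
      refine continuous_finsetSum _ fun σ _ => Continuous.matrix_det ?_
      refine continuous_matrix fun k j => ?_
      simp only [of_apply]
      fun_prop
    exact (hcont.tendsto _).comp (tendsto_pi_nhds.2 fun i => hcov i x)
  have hseq : Tendsto (fun m : ℕ => 1 / ((m : ℝ) + 1)) atTop (𝓝 0) :=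
    tendsto_one_div_add_atTop_nhds_zero_nat
  have hnnK : ∀ x, 0 ≤ mixedDet (fun i => gibbsCov (t i) (fun _ => 1) x) := fun x =>
    mixedDet_nonneg fun i => ((hpotK i).posDef x).posSemidef
  have hnnL : ∀ ε > 0, ∀ x, 0 ≤ mixedDet (fun i => gibbsCov (T i) (c ε i) x) := fun ε hε x =>
    mixedDet_nonneg fun i => ((hpotL ε hε i).posDef x).posSemidef
  have hKl : ENNReal.ofReal (mixedVolume K) =
      ∫⁻ x, ENNReal.ofReal (mixedDet (fun i => gibbsCov (t i) (fun _ => 1) x)) := by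
    rw [hA.2, ofReal_integral_eq_lintegral_ofReal hA.1 (Eventually.of_forall hnnK)]
  have hLl : ∀ ε > 0, ENNReal.ofReal (mixedVolume L) =
      ∫⁻ x, ENNReal.ofReal (mixedDet (fun i => gibbsCov (T i) (c ε i) x)) := by
    intro ε hε
    rw [(hB ε hε).2, ofReal_integral_eq_lintegral_ofReal (hB ε hε).1
      (Eventually.of_forall (hnnL ε hε))]
  have hL0 : 0 ≤ mixedVolume L := by
    rw [(hB 1 one_pos).2]
    exact integral_nonneg (hnnL 1 one_pos)
  have hpos : ∀ m : ℕ, (0 : ℝ) < 1 / ((m : ℝ) + 1) := fun m => by positivity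
  rw [← ENNReal.ofReal_le_ofReal_iff hL0, hKl]
  calc ∫⁻ x, ENNReal.ofReal (mixedDet (fun i => gibbsCov (t i) (fun _ => 1) x))
      = ∫⁻ x, liminf (fun m : ℕ => ENNReal.ofReal
          (mixedDet (fun i => gibbsCov (T i) (c (1 / ((m : ℝ) + 1)) i) x))) atTop := by
        refine lintegral_congr fun x => ?_
        exact (ENNReal.tendsto_ofReal ((hmixed x).comp hseq)).liminf_eq.symm
    _ ≤ liminf (fun m : ℕ => ∫⁻ x, ENNReal.ofReal
          (mixedDet (fun i => gibbsCov (T i) (c (1 / ((m : ℝ) + 1)) i) x))) atTop := by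
        refine lintegral_liminf_le' fun m => ?_
        exact (hB _ (hpos m)).1.aestronglyMeasurable.aemeasurable.ennreal_ofReal
    _ = ENNReal.ofReal (mixedVolume L) := by
        simp only [← hLl _ (hpos _), liminf_const]

end

/-! ### Truncation of upper sets -/

/-- The lower orthant with apex `(R, …, R)`, by which upper sets are truncated. -/
def lowerOrthant (n : ℕ) (R : ℝ) : Set (Fin n → ℝ) := Set.Iic fun _ => R

lemma mem_lowerOrthant {R : ℝ} {x : Fin n → ℝ} : x ∈ lowerOrthant n R ↔ ∀ i, x i ≤ R := Iff.rfl

/-- An upper set `A` is regular at level `R` if the truncation of `A` at `R` is a full-dimensional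
polytope `K` with `A = K + C`, where `C` is the orthant. The last condition is expressed by saying
that cutting off the coordinates of a point of `A` at `R` gives a point of `A`. -/
structure IsRegular (A : Set (Fin n → ℝ)) (R : ℝ) : Prop where
  upper : IsUpperSet A
  core : ∃ r < R, (fun _ => r) ∈ A
  inf_mem : ∀ x ∈ A, x ⊓ (fun _ => R) ∈ A
  hull : ∃ T : Finset (Fin n → ℝ), A ∩ lowerOrthant n R = convexHull ℝ (T : Set (Fin n → ℝ))

lemma IsRegular.isFullPolytope {A : Set (Fin n → ℝ)} {R : ℝ} (h : IsRegular A R) :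
    IsFullPolytope (A ∩ lowerOrthant n R) := by
  refine ⟨h.hull, ?_⟩
  obtain ⟨r, hr, hA⟩ := h.core
  have hsub : Set.pi Set.univ (fun _ : Fin n => Set.Ioo r R) ⊆ A ∩ lowerOrthant n R := by
    intro x hx
    exact ⟨h.upper (fun i => (hx i trivial).1.le) hA, fun i => (hx i trivial).2.le⟩
  have hopen : IsOpen (Set.pi Set.univ (fun _ : Fin n => Set.Ioo r R)) :=
    isOpen_set_pi Set.finite_univ fun _ _ => isOpen_Ioo
  refine ⟨fun _ => (r + R) / 2, interior_maximal hsub hopen fun i _ => ⟨?_, ?_⟩⟩ <;> linarith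

lemma IsRegular.mem_lowerOrthant_add {A A' : Set (Fin n → ℝ)} {R R' : ℝ} (h : IsRegular A R)
    (h' : IsRegular A' R') :
    (A + A') ∩ lowerOrthant n (R + R') = A ∩ lowerOrthant n R + A' ∩ lowerOrthant n R' := by
  ext z
  constructor
  · rintro ⟨⟨x, hx, x', hx', rfl⟩, hz⟩
    -- give the second summand its cut-off part, and to the first one as much as it may have
    set y' := x' ⊓ (fun _ => R') with hy'
    set y := (x + x' - y') ⊓ (fun _ => R) with hy
    refine ⟨y, ⟨h.upper ?_ (h.inf_mem x hx), fun i => inf_le_right⟩, x + x' - y,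
      ⟨h'.upper ?_ (h'.inf_mem x' hx'), ?_⟩, by simp⟩
    · refine le_inf (inf_le_left.trans ?_) inf_le_right
      have : y' ≤ x' := inf_le_left
      intro i
      have := this i
      simp only [Pi.sub_apply, Pi.add_apply]
      linarith
    · have : y ≤ x + x' - y' := inf_le_left
      intro i
      have := this i
      simp only [Pi.sub_apply, Pi.add_apply] at this ⊢
      change y' i ≤ _
      linarith
    · intro i
      have hzi := hz i
      have hy'R : y' i ≤ R' := inf_le_right (a := x' i)
      simp only [Pi.sub_apply, Pi.add_apply] at hzi ⊢
      have : y i = min (x i + x' i - y' i) R := rfl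
      rcases min_choice (x i + x' i - y' i) R with hc | hc <;> rw [this, hc]
      · linarith
      · linarith
  · rintro ⟨x, ⟨hx, hxR⟩, x', ⟨hx', hxR'⟩, rfl⟩
    exact ⟨Set.add_mem_add hx hx', fun i => add_le_add (hxR i) (hxR' i)⟩

lemma IsRegular.add {A A' : Set (Fin n → ℝ)} {R R' : ℝ} (h : IsRegular A R)
    (h' : IsRegular A' R') : IsRegular (A + A') (R + R') where
  upper := by
    rintro _ y hxy ⟨x, hx, x', hx', rfl⟩
    refine ⟨x + (y - (x + x')), h.upper (by simpa using hxy) hx, x', hx', ?_⟩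
    simp only
    abel
  core := by
    obtain ⟨r, hr, hA⟩ := h.core
    obtain ⟨r', hr', hA'⟩ := h'.core
    exact ⟨r + r', add_lt_add hr hr', _, hA, _, hA', rfl⟩
  inf_mem := by
    rintro _ ⟨x, hx, x', hx', rfl⟩
    set y := x ⊓ (fun _ => R)
    set y' := x' ⊓ (fun _ => R')
    have h1 : y + y' ≤ (x + x') ⊓ (fun _ => R + R') :=
      le_inf (add_le_add inf_le_left inf_le_left)
        (add_le_add (inf_le_right : y ≤ _) (inf_le_right : y' ≤ _))
    refine ⟨y + ((x + x') ⊓ (fun _ => R + R') - (y + y')),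
      h.upper (le_add_of_nonneg_right (sub_nonneg.2 h1)) (h.inf_mem x hx), y',
      h'.inf_mem x' hx', ?_⟩
    simp only
    abel
  hull := by
    classical
    obtain ⟨T, hT⟩ := h.hull
    obtain ⟨T', hT'⟩ := h'.hull
    refine ⟨T + T', ?_⟩
    rw [h.mem_lowerOrthant_add h', hT, hT', ← convexHull_add, Finset.coe_add]

/-! ### Pairs of regular sets -/

/-- Pairs of sets that are regular at level `R` and agree outside of the lower orthant of `R`. -/
structure IsRegularPair (P : Set (Fin n → ℝ) × Set (Fin n → ℝ)) (R : ℝ) : Prop where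
  fst : IsRegular P.1 R
  snd : IsRegular P.2 R
  symmDiff_subset : symmDiff P.1 P.2 ⊆ lowerOrthant n R

lemma IsRegularPair.swap {P : Set (Fin n → ℝ) × Set (Fin n → ℝ)} {R : ℝ}
    (h : IsRegularPair P R) : IsRegularPair P.swap R :=
  ⟨h.snd, h.fst, by rw [symmDiff_comm]; exact h.symmDiff_subset⟩

lemma IsRegularPair.mem_snd {P : Set (Fin n → ℝ) × Set (Fin n → ℝ)} {R : ℝ}
    (h : IsRegularPair P R) {x : Fin n → ℝ} (hx : x ∈ P.1) {i : Fin n} (hi : R < x i) :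
    x ∈ P.2 := by
  by_contra hc
  exact absurd (h.symmDiff_subset (Or.inl ⟨hx, hc⟩) i) (not_le.2 hi)

/-- A point of `P.1 + P'.1` with a coordinate above `R + R'` can be split so that this coordinate
lies above `R` and `R'` in the summands. -/
lemma IsRegularPair.add_diff_subset {P P' : Set (Fin n → ℝ) × Set (Fin n → ℝ)} {R R' : ℝ}
    (h : IsRegularPair P R) (h' : IsRegularPair P' R') :
    (P.1 + P'.1) \ (P.2 + P'.2) ⊆ lowerOrthant n (R + R') := by
  rintro z ⟨⟨x, hx, x', hx', rfl⟩, hz⟩ i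
  by_contra! hi
  refine hz ?_
  simp only [Pi.add_apply] at hi
  set y := x ⊓ (fun _ => R) with hy
  set y' := x' ⊓ (fun _ => R') with hy'
  set d : Fin n → ℝ := x + x' - (y + y') with hd
  have hd0 : 0 ≤ d := sub_nonneg.2 (add_le_add inf_le_left inf_le_left)
  have hyR : y i ≤ R := inf_le_right (a := x i)
  have hyR' : y' i ≤ R' := inf_le_right (a := x' i)
  have hdi : d i = x i + x' i - (y i + y' i) := rfl
  -- the share of the surplus `d` that goes to the first summand
  set s : ℝ := (R - y i + (x i + x' i - (R + R')) / 2) / d i with hs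
  have hdpos : 0 < d i := by rw [hdi]; linarith
  have hs0 : 0 ≤ s := div_nonneg (by linarith) hdpos.le
  have hs1 : s ≤ 1 := by rw [hs, div_le_one hdpos, hdi]; linarith
  have hsd : s * d i = R - y i + (x i + x' i - (R + R')) / 2 := div_mul_cancel₀ _ hdpos.ne'
  have h1 : y + s • d ∈ P.1 := h.fst.upper (le_add_of_nonneg_right (smul_nonneg hs0 hd0))
    (h.fst.inf_mem x hx)
  have h2 : y' + (1 - s) • d ∈ P'.1 :=
    h'.fst.upper (le_add_of_nonneg_right (smul_nonneg (sub_nonneg.2 hs1) hd0))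
      (h'.fst.inf_mem x' hx')
  refine ⟨_, h.mem_snd h1 (i := i) ?_, _, h'.mem_snd h2 (i := i) ?_, ?_⟩
  · simp only [Pi.add_apply, Pi.smul_apply, smul_eq_mul]
    linarith
  · simp only [Pi.add_apply, Pi.smul_apply, smul_eq_mul, sub_mul, one_mul, hsd]
    linarith
  · simp only [hd]
    module

lemma IsRegularPair.add {P P' : Set (Fin n → ℝ) × Set (Fin n → ℝ)} {R R' : ℝ}
    (h : IsRegularPair P R) (h' : IsRegularPair P' R') : IsRegularPair (P + P') (R + R') := by
  refine ⟨h.fst.add h'.fst, h.snd.add h'.snd, ?_⟩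
  rw [symmDiff_def]
  exact Set.union_subset (h.add_diff_subset h') (h.swap.add_diff_subset h'.swap)

lemma IsRegularPair.sum {P : Fin n → Set (Fin n → ℝ) × Set (Fin n → ℝ)} {R : Fin n → ℝ}
    (h : ∀ i, IsRegularPair (P i) (R i)) {S : Finset (Fin n)} (hS : S.Nonempty) :
    IsRegularPair (∑ i ∈ S, P i) (∑ i ∈ S, R i) ∧
    (∑ i ∈ S, P i).1 ∩ lowerOrthant n (∑ i ∈ S, R i) =
      ∑ i ∈ S, ((P i).1 ∩ lowerOrthant n (R i)) ∧
    (∑ i ∈ S, P i).2 ∩ lowerOrthant n (∑ i ∈ S, R i) =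
      ∑ i ∈ S, ((P i).2 ∩ lowerOrthant n (R i)) := by
  induction hS using Finset.Nonempty.cons_induction with
  | singleton a => simpa using h a
  | cons a s ha hs ih =>
    obtain ⟨h1, h2, h3⟩ := ih
    simp only [Finset.sum_cons, ← h2, ← h3]
    exact ⟨(h a).add h1, (h a).fst.mem_lowerOrthant_add h1.fst,
      (h a).snd.mem_lowerOrthant_add h1.snd⟩

lemma IsRegularPair.pairVolume_eq {P : Set (Fin n → ℝ) × Set (Fin n → ℝ)} {R : ℝ}
    (h : IsRegularPair P R) :
    pairVolume P = n.factorial *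
      (volume.real (P.1 ∩ lowerOrthant n R) - volume.real (P.2 ∩ lowerOrthant n R)) := by
  have key : ∀ {P : Set (Fin n → ℝ) × Set (Fin n → ℝ)}, IsRegularPair P R →
      volume.real (P.1 ∩ lowerOrthant n R) =
        volume.real (P.1 \ P.2) + volume.real (P.1 ∩ P.2 ∩ lowerOrthant n R) := by
    intro P h
    have hfin : volume (P.1 ∩ lowerOrthant n R) ≠ ⊤ :=
      h.fst.isFullPolytope.isBody.2.1.measure_lt_top.ne
    have hm : NullMeasurableSet (P.1 ∩ P.2 ∩ lowerOrthant n R) := by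
      rw [Set.inter_inter_distrib_right]
      exact ((h.fst.isFullPolytope.isBody.1).nullMeasurableSet volume).inter
        ((h.snd.isFullPolytope.isBody.1).nullMeasurableSet volume)
    have hd : P.1 \ P.2 = (P.1 ∩ lowerOrthant n R) \ (P.1 ∩ P.2 ∩ lowerOrthant n R) := by
      ext x
      constructor
      · rintro ⟨h1, h2⟩
        exact ⟨⟨h1, h.symmDiff_subset (Or.inl ⟨h1, h2⟩)⟩, fun hc => h2 hc.1.2⟩
      · rintro ⟨⟨h1, h2⟩, h3⟩
        exact ⟨h1, fun hc => h3 ⟨⟨h1, hc⟩, h2⟩⟩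
    have hi : (P.1 ∩ lowerOrthant n R) ∩ (P.1 ∩ P.2 ∩ lowerOrthant n R) =
        P.1 ∩ P.2 ∩ lowerOrthant n R := by
      ext x; simp only [Set.mem_inter_iff]; tauto
    rw [hd, ← measureReal_inter_add_sdiff₀ hm hfin, hi, add_comm]
  have h1 := key h
  have h2 := key h.swap
  simp only [Prod.fst_swap, Prod.snd_swap] at h2
  rw [pairVolume, h1, h2, Set.inter_comm P.2 P.1]
  ring

/-- The pairs that are regular at some level. -/
def regularPairs (n : ℕ) : Set (Set (Fin n → ℝ) × Set (Fin n → ℝ)) :=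
  {P | ∃ R, IsRegularPair P R}

/-! ### Existence of the relative mixed volume -/

/-- The relative mixed volume, by the polarization formula. -/
noncomputable def relMixedVolume (P : Fin n → Set (Fin n → ℝ) × Set (Fin n → ℝ)) : ℝ :=
  (n.factorial : ℝ)⁻¹ * altSum (fun S => pairVolume (∑ i ∈ S, P i))

lemma relMixedVolume_comp_perm (P : Fin n → Set (Fin n → ℝ) × Set (Fin n → ℝ))
    (σ : Equiv.Perm (Fin n)) : relMixedVolume (fun i => P (σ i)) = relMixedVolume P := by
  unfold relMixedVolume
  rw [← altSum_map_equiv σ (fun S => pairVolume (∑ i ∈ S, P i))]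
  simp only [Finset.sum_map, Equiv.coe_toEmbedding]

/-- Truncation expresses the relative mixed volume by mixed volumes of polytopes. -/
lemma relMixedVolume_eq {P : Fin n → Set (Fin n → ℝ) × Set (Fin n → ℝ)} {R : Fin n → ℝ}
    (h : ∀ i, IsRegularPair (P i) (R i)) :
    relMixedVolume P = mixedVolume (fun i => (P i).1 ∩ lowerOrthant n (R i)) -
      mixedVolume (fun i => (P i).2 ∩ lowerOrthant n (R i)) := by
  have hS : ∀ S : Finset (Fin n), pairVolume (∑ i ∈ S, P i) = n.factorial *
      (volume.real (∑ i ∈ S, ((P i).1 ∩ lowerOrthant n (R i))) -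
        volume.real (∑ i ∈ S, ((P i).2 ∩ lowerOrthant n (R i)))) := by
    intro S
    rcases S.eq_empty_or_nonempty with rfl | hS
    · simp [pairVolume]
    · obtain ⟨h1, h2, h3⟩ := IsRegularPair.sum h hS
      rw [h1.pairVolume_eq, h2, h3]
  unfold relMixedVolume mixedVolume
  simp only [hS]
  rw [altSum_const_mul, altSum_sub, inv_mul_cancel_left₀]
  exact_mod_cast n.factorial_ne_zero

lemma additiveOn_relMixedVolume (hn : 0 < n) :
    AdditiveOn (regularPairs n) (relMixedVolume (n := n)) := by
  intro P hP i Q hQ T hT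
  choose R hR using hP
  obtain ⟨r, hr⟩ := hQ
  obtain ⟨r', hr'⟩ := hT
  have key : ∀ {Q : Set (Fin n → ℝ) × Set (Fin n → ℝ)} {r : ℝ}, IsRegularPair Q r →
      relMixedVolume (Function.update P i Q) =
        mixedVolume (Function.update (fun j => (P j).1 ∩ lowerOrthant n (R j)) i
          (Q.1 ∩ lowerOrthant n r)) -
        mixedVolume (Function.update (fun j => (P j).2 ∩ lowerOrthant n (R j)) i
          (Q.2 ∩ lowerOrthant n r)) := by
    intro Q r hr
    rw [relMixedVolume_eq (R := Function.update R i r)]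
    · congr 2
      all_goals
        ext1 j
        by_cases hj : j = i
        · subst hj; simp
        · simp [hj]
    · intro j
      by_cases hj : j = i
      · subst hj; simpa
      · simpa [hj] using hR j
  rw [key (hr.add hr'), key hr, key hr', Prod.fst_add, Prod.snd_add,
    hr.fst.mem_lowerOrthant_add hr'.fst, hr.snd.mem_lowerOrthant_add hr'.snd,
    mixedVolume_update_add hn (fun j => (hR j).fst.isFullPolytope.isBody) i
      hr.fst.isFullPolytope.isBody hr'.fst.isFullPolytope.isBody,
    mixedVolume_update_add hn (fun j => (hR j).snd.isFullPolytope.isBody) i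
      hr.snd.isFullPolytope.isBody hr'.snd.isFullPolytope.isBody]
  ring

lemma relMixedVolume_const (hn : 0 < n) {P : Set (Fin n → ℝ) × Set (Fin n → ℝ)}
    (hP : P ∈ regularPairs n) : relMixedVolume (fun _ => P) = pairVolume P := by
  obtain ⟨R, hR⟩ := hP
  rw [relMixedVolume_eq (fun _ => hR), mixedVolume_const hn hR.fst.isFullPolytope.isBody,
    mixedVolume_const hn hR.snd.isFullPolytope.isBody, hR.pairVolume_eq]
  ring

/-- The relative mixed volume of pairs `(A, B i)` decreases when the sets `B i` grow. -/
lemma relMixedVolume_anti (hn : 0 < n) {A : Set (Fin n → ℝ)} {B B' : Fin n → Set (Fin n → ℝ)}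
    (hB : ∀ i, ∀ᶠ R in atTop, IsRegularPair (A, B i) R)
    (hB' : ∀ i, ∀ᶠ R in atTop, IsRegularPair (A, B' i) R) (h : ∀ i, B i ⊆ B' i) :
    relMixedVolume (fun i => (A, B' i)) ≤ relMixedVolume (fun i => (A, B i)) := by
  obtain ⟨R, hR, hR'⟩ := ((eventually_all.2 hB).and (eventually_all.2 hB')).exists
  rw [relMixedVolume_eq hR, relMixedVolume_eq hR']
  refine sub_le_sub_left (mixedVolume_mono hn (fun i => (hR i).snd.isFullPolytope)
    (fun i => (hR' i).snd.isFullPolytope) fun i => ?_) _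
  exact Set.inter_subset_inter_left _ (h i)

/-! ### Polyhedra -/

/-- Intersections of finitely many closed half-spaces in an arbitrary real vector space. -/
def IsPolyhedral {V : Type*} [AddCommGroup V] [Module ℝ V] (K : Set V) : Prop :=
  ∃ s : Finset (Module.Dual ℝ V × ℝ), K = {x | ∀ p ∈ s, p.2 ≤ p.1 x}

section Polyhedral

variable {V W : Type*} [AddCommGroup V] [Module ℝ V] [AddCommGroup W] [Module ℝ W]

lemma IsPolyhedral.inter {K L : Set V} (hK : IsPolyhedral K) (hL : IsPolyhedral L) :
    IsPolyhedral (K ∩ L) := by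
  classical
  obtain ⟨s, rfl⟩ := hK
  obtain ⟨t, rfl⟩ := hL
  refine ⟨s ∪ t, ?_⟩
  ext x
  simp only [Finset.mem_union, Set.mem_inter_iff, Set.mem_ofPred_eq]
  exact ⟨fun h p hp => hp.elim (h.1 p) (h.2 p),
    fun h => ⟨fun p hp => h p (Or.inl hp), fun p hp => h p (Or.inr hp)⟩⟩

lemma IsPolyhedral.preimage {K : Set W} (hK : IsPolyhedral K) (f : V →ₗ[ℝ] W) :
    IsPolyhedral (f ⁻¹' K) := by
  classical
  obtain ⟨s, rfl⟩ := hK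
  refine ⟨s.image fun p => (p.1.comp f, p.2), ?_⟩
  ext x
  simp only [Set.mem_preimage, Set.mem_ofPred_eq, Finset.forall_mem_image, LinearMap.comp_apply]

lemma exists_forall_le_and_forall_ge {ι κ : Type*} (s : Finset ι) (t : Finset κ) (f : ι → ℝ)
    (g : κ → ℝ) (h : ∀ i ∈ s, ∀ j ∈ t, f i ≤ g j) :
    ∃ c, (∀ i ∈ s, f i ≤ c) ∧ ∀ j ∈ t, c ≤ g j := by
  rcases s.eq_empty_or_nonempty with rfl | hs
  · rcases t.eq_empty_or_nonempty with rfl | ht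
    · exact ⟨0, by simp, by simp⟩
    · exact ⟨t.inf' ht g, by simp, fun j hj => Finset.inf'_le g hj⟩
  · exact ⟨s.sup' hs f, fun i hi => Finset.le_sup' f hi,
      fun j hj => Finset.sup'_le hs f fun i hi => h i hi j hj⟩

/-- **Fourier–Motzkin elimination** in the direction `v`. -/
lemma IsPolyhedral.exists_add_smul {K : Set V} (hK : IsPolyhedral K) (v : V) :
    IsPolyhedral {x | ∃ t : ℝ, x + t • v ∈ K} := by
  classical
  obtain ⟨s, rfl⟩ := hK
  set s₀ := s.filter fun p => p.1 v = 0
  set s₁ := s.filter fun p => 0 < p.1 v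
  set s₂ := s.filter fun p => p.1 v < 0
  refine ⟨s₀ ∪ (s₁ ×ˢ s₂).image fun pq =>
    ((-(pq.2.1 v)) • pq.1.1 + (pq.1.1 v) • pq.2.1, -(pq.2.1 v) * pq.1.2 + pq.1.1 v * pq.2.2), ?_⟩
  ext x
  simp only [Set.mem_ofPred_eq, map_add, map_smul, smul_eq_mul]
  constructor
  · rintro ⟨t, ht⟩ p hp
    rcases Finset.mem_union.1 hp with hp | hp
    · obtain ⟨hp, h0⟩ := Finset.mem_filter.1 hp
      simpa [h0] using ht p hp
    · obtain ⟨⟨q, r⟩, hqr, rfl⟩ := Finset.mem_image.1 hp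
      obtain ⟨hq, hr⟩ := Finset.mem_product.1 hqr
      obtain ⟨hq, hq0⟩ := Finset.mem_filter.1 hq
      obtain ⟨hr, hr0⟩ := Finset.mem_filter.1 hr
      have h1 := mul_le_mul_of_nonneg_left (ht q hq) (neg_nonneg.2 hr0.le)
      have h2 := mul_le_mul_of_nonneg_left (ht r hr) hq0.le
      simp only [LinearMap.add_apply, LinearMap.smul_apply, smul_eq_mul]
      linarith
  · intro h
    obtain ⟨t, ht1, ht2⟩ := exists_forall_le_and_forall_ge s₁ s₂
      (fun p => (p.2 - p.1 x) / p.1 v) (fun p => (p.2 - p.1 x) / p.1 v) (by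
        intro q hq r hr
        have hqr := h _ (Finset.mem_union_right _ (Finset.mem_image_of_mem _
          (Finset.mk_mem_product hq hr)))
        have hq0 := (Finset.mem_filter.1 hq).2
        have hr0 := (Finset.mem_filter.1 hr).2
        simp only [LinearMap.add_apply, LinearMap.smul_apply, smul_eq_mul] at hqr
        rw [div_le_iff₀ hq0, div_mul_eq_mul_div, le_div_iff_of_neg hr0]
        linarith)
    refine ⟨t, fun p hp => ?_⟩
    rcases lt_trichotomy (p.1 v) 0 with h0 | h0 | h0
    · have := ht2 p (Finset.mem_filter.2 ⟨hp, h0⟩)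
      rw [le_div_iff_of_neg h0] at this
      linarith
    · have := h p (Finset.mem_union_left _ (Finset.mem_filter.2 ⟨hp, h0⟩))
      rw [h0]
      linarith
    · have := ht1 p (Finset.mem_filter.2 ⟨hp, h0⟩)
      rw [div_le_iff₀ h0] at this
      linarith

lemma IsPolyhedral.exists_add_sum_smul {ι : Type*} {K : Set V} (hK : IsPolyhedral K) (v : ι → V)
    (s : Finset ι) : IsPolyhedral {x | ∃ t : ι → ℝ, x + ∑ i ∈ s, t i • v i ∈ K} := by
  classical
  induction s using Finset.induction_on with
  | empty => simpa using hK
  | insert a s ha ih =>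
    convert ih.exists_add_smul (v a) using 1
    ext x
    simp only [Set.mem_ofPred_eq]
    constructor
    · rintro ⟨t, ht⟩
      refine ⟨t a, t, ?_⟩
      rwa [Finset.sum_insert ha, ← add_assoc] at ht
    · rintro ⟨r, t, ht⟩
      refine ⟨Function.update t a r, ?_⟩
      have h1 : ∑ i ∈ s, Function.update t a r i • v i = ∑ i ∈ s, t i • v i :=
        Finset.sum_congr rfl fun i hi => by rw [Function.update_of_ne (ne_of_mem_of_not_mem hi ha)]
      rwa [Finset.sum_insert ha, Function.update_self, ← add_assoc, h1]

end Polyhedral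

lemma IsPolyhedron.add {A B : Set (Fin n → ℝ)} (hA : IsPolyhedron A) (hB : IsPolyhedron B) :
    IsPolyhedron (A + B) := by
  -- `A + B` is the shadow of `{(z, y) | z - y ∈ A, y ∈ B}`
  have hA' : IsPolyhedral ((LinearMap.fst ℝ (Fin n → ℝ) (Fin n → ℝ) -
      LinearMap.snd ℝ (Fin n → ℝ) (Fin n → ℝ)) ⁻¹' A) := IsPolyhedral.preimage hA _
  have hB' : IsPolyhedral ((LinearMap.snd ℝ (Fin n → ℝ) (Fin n → ℝ)) ⁻¹' B) :=
    IsPolyhedral.preimage hB _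
  have h := (hA'.inter hB').exists_add_sum_smul
    (fun i : Fin n => ((0 : Fin n → ℝ), (Pi.single i 1 : Fin n → ℝ))) Finset.univ
  have h' : IsPolyhedron _ := h.preimage (LinearMap.inl ℝ (Fin n → ℝ) (Fin n → ℝ))
  convert! h' using 1
  ext z
  have hsum : ∀ t : Fin n → ℝ, ∑ i, t i • ((0 : Fin n → ℝ), (Pi.single i 1 : Fin n → ℝ)) =
      (0, t) := by
    intro t
    ext j
    · simp [Prod.fst_sum]
    · simp [Prod.snd_sum, Finset.sum_apply, Pi.single_apply]
  simp only [Set.mem_preimage, Set.mem_ofPred_eq, hsum, LinearMap.inl_apply, Prod.mk_add_mk,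
    add_zero, zero_add, Set.mem_inter_iff, LinearMap.sub_apply, LinearMap.fst_apply,
    LinearMap.snd_apply]
  constructor
  · rintro ⟨a, ha, b, hb, rfl⟩
    exact ⟨b, by simpa using ha, hb⟩
  · rintro ⟨t, h1, h2⟩
    exact ⟨_, h1, t, h2, by simp⟩

lemma IsPolyhedron.isClosed {K : Set (Fin n → ℝ)} (hK : IsPolyhedron K) : IsClosed K := by
  obtain ⟨s, rfl⟩ := hK
  have : {x : Fin n → ℝ | ∀ p ∈ s, p.2 ≤ p.1 x} = ⋂ p ∈ s, {x | p.2 ≤ p.1 x} := by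
    ext x; simp
  rw [this]
  exact isClosed_biInter fun p _ =>
    isClosed_le continuous_const p.1.continuous_of_finiteDimensional

lemma IsPolyhedron.convex {K : Set (Fin n → ℝ)} (hK : IsPolyhedron K) : Convex ℝ K := by
  obtain ⟨s, rfl⟩ := hK
  have : {x : Fin n → ℝ | ∀ p ∈ s, p.2 ≤ p.1 x} = ⋂ p ∈ s, {x | p.2 ≤ p.1 x} := by
    ext x; simp
  rw [this]
  exact convex_iInter₂ fun p _ => convex_halfSpace_ge p.1.isLinear _

/-- A vertex of a polyhedron is determined by the set of inequalities that are tight there. -/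
lemma IsPolyhedron.finite_extremePoints {K : Set (Fin n → ℝ)} (hK : IsPolyhedron K) :
    (K.extremePoints ℝ).Finite := by
  classical
  obtain ⟨s, hs⟩ := hK
  refine Set.Finite.of_finite_image (f := fun x => s.filter fun p => p.1 x = p.2)
    ((s.powerset.finite_toSet).subset ?_) ?_
  · rintro _ ⟨x, _, rfl⟩
    exact Finset.mem_coe.2 (Finset.mem_powerset.2 (Finset.filter_subset _ _))
  · intro x hx y hy hxy
    by_contra hne
    have hxK : ∀ p ∈ s, p.2 ≤ p.1 x := by have := hx.1; rwa [hs] at this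
    have hyK : ∀ p ∈ s, p.2 ≤ p.1 y := by have := hy.1; rwa [hs] at this
    have hev : ∀ᶠ t : ℝ in 𝓝 0, ∀ p ∈ s, p.2 ≤ p.1 (x + t • (x - y)) := by
      rw [Finset.eventually_all]
      intro p hp
      by_cases hpx : p.1 x = p.2
      · have hpy : p.1 y = p.2 := by
          have : p ∈ s.filter fun p => p.1 x = p.2 := Finset.mem_filter.2 ⟨hp, hpx⟩
          rw [show s.filter (fun p => p.1 x = p.2) = s.filter fun p => p.1 y = p.2 from hxy] at this
          exact (Finset.mem_filter.1 this).2
        exact Eventually.of_forall fun t => by simp [hpx, hpy]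
      · have hlt : p.2 < p.1 x := lt_of_le_of_ne (hxK p hp) (Ne.symm hpx)
        have hc : Continuous fun t : ℝ => p.1 (x + t • (x - y)) := by
          have := p.1.continuous_of_finiteDimensional
          fun_prop
        have := hc.tendsto 0
        simp only [zero_smul, add_zero] at this
        exact (this.eventually (lt_mem_nhds hlt)).mono fun t ht => ht.le
    obtain ⟨t, ht, ht0⟩ := ((hev.filter_mono nhdsWithin_le_nhds).and
      (self_mem_nhdsWithin : Set.Ioi (0 : ℝ) ∈ 𝓝[>] 0)).exists
    have ht0 : 0 < t := ht0
    have hz : x + t • (x - y) ∈ K := by rw [hs]; exact ht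
    have hseg : x ∈ openSegment ℝ y (x + t • (x - y)) := by
      refine ⟨t / (1 + t), 1 / (1 + t), by positivity, by positivity, by field_simp; ring, ?_⟩
      ext i
      simp only [Pi.add_apply, Pi.smul_apply, Pi.sub_apply, smul_eq_mul]
      field_simp
      ring
    exact hne ((mem_extremePoints.1 hx).2 y hy.1 _ hz hseg).1.symm

lemma IsPolyhedron.exists_eq_convexHull {K : Set (Fin n → ℝ)} (hK : IsPolyhedron K)
    (hb : Bornology.IsBounded K) :
    ∃ T : Finset (Fin n → ℝ), K = convexHull ℝ (T : Set (Fin n → ℝ)) := by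
  have hcomp : IsCompact K := Metric.isCompact_of_isClosed_isBounded hK.isClosed hb
  refine ⟨hK.finite_extremePoints.toFinset, ?_⟩
  rw [Set.Finite.coe_toFinset, ← (hK.finite_extremePoints.isClosed_convexHull ℝ).closure_eq]
  exact (closure_convexHull_extremePoints hcomp hK.convex).symm

lemma isPolyhedron_lowerOrthant (R : ℝ) : IsPolyhedron (lowerOrthant n R) := by
  classical
  refine ⟨Finset.univ.image fun i : Fin n => (-(LinearMap.proj i), -R), ?_⟩
  ext x
  simp [mem_lowerOrthant]

lemma isPolyhedron_orthant : IsPolyhedron (orthant n) := by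
  classical
  refine ⟨Finset.univ.image fun i : Fin n => (LinearMap.proj i, 0), ?_⟩
  ext x
  simp [orthant]

/-! ### Polyhedra with the support cone of the orthant -/

lemma dual_apply (γ : Module.Dual ℝ (Fin n → ℝ)) (x : Fin n → ℝ) :
    γ x = ∑ i, x i * γ (Pi.single i 1) := by
  conv_lhs => rw [← Finset.univ_sum_single x]
  rw [map_sum]
  refine Finset.sum_congr rfl fun i _ => ?_
  rw [← smul_eq_mul, ← map_smul]
  congr 1
  ext j
  simp [Pi.single_apply]

lemma mem_supportCone_orthant {γ : Module.Dual ℝ (Fin n → ℝ)} :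
    γ ∈ supportCone (orthant n) ↔ ∀ i, 0 ≤ γ (Pi.single i 1) := by
  constructor
  · rintro ⟨m, hm⟩ i
    by_contra! hneg
    have h : (fun j => (((|m| + 1) / -γ (Pi.single i 1)) • (Pi.single i 1 : Fin n → ℝ)) j) ∈
        orthant n := by
      intro j
      have h1 : (0 : ℝ) ≤ (|m| + 1) / -γ (Pi.single i 1) := by
        have := neg_pos.2 hneg
        positivity
      have h2 : (0 : ℝ) ≤ (Pi.single i 1 : Fin n → ℝ) j := by
        by_cases hj : j = i
        · subst hj; simp
        · simp [hj]
      exact mul_nonneg h1 h2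
    have h2 := hm ⟨_, h, rfl⟩
    have h3 : γ (((|m| + 1) / -γ (Pi.single i 1)) • (Pi.single i 1 : Fin n → ℝ)) = -(|m| + 1) := by
      rw [map_smul, smul_eq_mul, div_mul_eq_mul_div, div_neg, mul_div_assoc, div_self hneg.ne,
        mul_one]
    change m ≤ γ (((|m| + 1) / -γ (Pi.single i 1)) • (Pi.single i 1 : Fin n → ℝ)) at h2
    rw [h3] at h2
    have := neg_abs_le m
    linarith
  · intro h
    refine ⟨0, ?_⟩
    rintro _ ⟨x, hx, rfl⟩
    rw [dual_apply]
    exact Finset.sum_nonneg fun i _ => mul_nonneg (hx i) (h i)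

lemma dual_mono {γ : Module.Dual ℝ (Fin n → ℝ)} (h : ∀ i, 0 ≤ γ (Pi.single i 1))
    {x y : Fin n → ℝ} (hxy : x ≤ y) : γ x ≤ γ y := by
  rw [dual_apply γ x, dual_apply γ y]
  exact Finset.sum_le_sum fun i _ => mul_le_mul_of_nonneg_right (hxy i) (h i)

lemma proj_mem_supportCone_orthant (i : Fin n) :
    (LinearMap.proj i : Module.Dual ℝ (Fin n → ℝ)) ∈ supportCone (orthant n) := by
  rw [mem_supportCone_orthant]
  intro j
  by_cases h : i = j
  · subst h; simp
  · simp [h]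

lemma nonempty_of_supportCone (hn : 0 < n) {K : Set (Fin n → ℝ)}
    (h : supportCone K = supportCone (orthant n)) : K.Nonempty := by
  by_contra hne
  rw [Set.not_nonempty_iff_eq_empty] at hne
  have h1 : (-(LinearMap.proj ⟨0, hn⟩) : Module.Dual ℝ (Fin n → ℝ)) ∈ supportCone K := by
    simp [supportCone, hne]
  rw [h, mem_supportCone_orthant] at h1
  have := h1 ⟨0, hn⟩
  simp at this
  linarith

lemma exists_lower_bound {K : Set (Fin n → ℝ)}
    (h : supportCone K = supportCone (orthant n)) : ∃ L : ℝ, ∀ x ∈ K, ∀ i, L ≤ x i := by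
  have h1 : ∀ i : Fin n, ∃ l : ℝ, ∀ x ∈ K, l ≤ x i := by
    intro i
    have := proj_mem_supportCone_orthant i
    rw [← h] at this
    obtain ⟨l, hl⟩ := this
    exact ⟨l, fun x hx => hl ⟨x, hx, rfl⟩⟩
  choose l hl using h1
  obtain ⟨L, hL⟩ := (Set.finite_range l).bddBelow
  exact ⟨L, fun x hx i => (hL ⟨i, rfl⟩).trans (hl i x hx)⟩

lemma isBounded_inter_lowerOrthant {K : Set (Fin n → ℝ)}
    (h : supportCone K = supportCone (orthant n)) (R : ℝ) :
    Bornology.IsBounded (K ∩ lowerOrthant n R) := by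
  obtain ⟨L, hL⟩ := exists_lower_bound h
  refine (Metric.isBounded_Icc (fun _ : Fin n => L) (fun _ => R)).subset ?_
  rintro x ⟨hx, hxR⟩
  exact ⟨fun i => hL x hx i, hxR⟩

lemma IsPolyhedron.isUpperSet {K : Set (Fin n → ℝ)} (hK : IsPolyhedron K)
    (h : supportCone K = supportCone (orthant n)) : IsUpperSet K := by
  obtain ⟨s, rfl⟩ := hK
  intro x y hxy hx p hp
  have hpos : p.1 ∈ supportCone (orthant n) := by
    rw [← h]
    refine ⟨p.2, ?_⟩
    rintro _ ⟨z, hz, rfl⟩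
    exact hz p hp
  exact (hx p hp).trans (dual_mono (mem_supportCone_orthant.1 hpos) hxy)

/-- If a coordinate that matters to an inequality of the polyhedron is cut off at a large level, then
the inequality still holds, because the coefficients are nonnegative. -/
lemma IsPolyhedron.eventually_isRegular (hn : 0 < n) {K : Set (Fin n → ℝ)} (hK : IsPolyhedron K)
    (h : supportCone K = supportCone (orthant n)) : ∀ᶠ R in atTop, IsRegular K R := by
  have hne := nonempty_of_supportCone hn h
  have hup := hK.isUpperSet h
  obtain ⟨L, hL⟩ := exists_lower_bound h
  obtain ⟨x₀, hx₀⟩ := hne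
  obtain ⟨s, hs⟩ := id hK
  have hpos : ∀ p ∈ s, ∀ i, 0 ≤ p.1 (Pi.single i 1) := by
    intro p hp
    rw [← mem_supportCone_orthant, ← h]
    refine ⟨p.2, ?_⟩
    rintro _ ⟨z, hz, rfl⟩
    rw [hs] at hz
    exact hz p hp
  have hlarge : ∀ᶠ R : ℝ in atTop, ∀ p ∈ s, ∀ i, 0 < p.1 (Pi.single i 1) →
      p.2 ≤ (R - L) * p.1 (Pi.single i 1) + ∑ k, L * p.1 (Pi.single k 1) := by
    rw [Finset.eventually_all]
    intro p _
    rw [eventually_all]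
    intro i
    by_cases hi : 0 < p.1 (Pi.single i 1)
    · have : Tendsto (fun R : ℝ => (R - L) * p.1 (Pi.single i 1) + ∑ k, L * p.1 (Pi.single k 1))
          atTop atTop :=
        tendsto_atTop_add_const_right _ _
          ((tendsto_atTop_add_const_right _ (-L) tendsto_id).atTop_mul_const hi)
      exact (this.eventually_ge_atTop p.2).mono fun R hR _ => hR
    · exact Eventually.of_forall fun R h => absurd h hi
  filter_upwards [hlarge, eventually_ge_atTop L, eventually_gt_atTop ‖x₀‖] with R hR hRL hRx
  refine ⟨hup, ⟨‖x₀‖, hRx, hup (fun i => (le_abs_self _).trans (norm_le_pi_norm x₀ i)) hx₀⟩, ?_, ?_⟩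
  · intro x hx
    have hxL := hL x hx
    rw [hs] at hx ⊢
    intro p hp
    by_cases hcut : ∃ i, 0 < p.1 (Pi.single i 1) ∧ R < x i
    · obtain ⟨i, hi, hRi⟩ := hcut
      refine (hR p hp i hi).trans ?_
      rw [dual_apply p.1 (x ⊓ _), ← Finset.add_sum_erase _ _ (Finset.mem_univ i),
        ← Finset.add_sum_erase _ _ (Finset.mem_univ i)]
      have h1 : (x ⊓ fun _ => R) i = R := inf_eq_right.2 hRi.le
      rw [h1]
      have h2 : ∑ k ∈ Finset.univ.erase i, L * p.1 (Pi.single k 1) ≤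
          ∑ k ∈ Finset.univ.erase i, (x ⊓ fun _ => R) k * p.1 (Pi.single k 1) :=
        Finset.sum_le_sum fun k _ => mul_le_mul_of_nonneg_right (le_inf (hxL k) hRL) (hpos p hp k)
      linarith
    · push Not at hcut
      refine (hx p hp).trans (le_of_eq ?_)
      rw [dual_apply p.1 x, dual_apply p.1 (x ⊓ _)]
      refine Finset.sum_congr rfl fun k _ => ?_
      rcases (hpos p hp k).eq_or_lt with h0 | h0
      · rw [← h0, mul_zero, mul_zero]
      · have h1 : (x ⊓ fun _ => R) k = x k := inf_eq_left.2 (hcut k h0)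
        rw [h1]
  · exact IsPolyhedron.exists_eq_convexHull
      (IsPolyhedral.inter hK (isPolyhedron_lowerOrthant R)) (isBounded_inter_lowerOrthant h R)

/-! ### The semigroup of pairs -/

/-- The pairs of polyhedra in the domain of the relative mixed volume. -/
abbrev orthantPairs (n : ℕ) : Set (Set (Fin n → ℝ) × Set (Fin n → ℝ)) :=
  polyhedronPairs (supportCone (orthant n))

lemma eventually_isRegularPair (hn : 0 < n) {P : Set (Fin n → ℝ) × Set (Fin n → ℝ)}
    (hP : P ∈ orthantPairs n) : ∀ᶠ R in atTop, IsRegularPair P R := by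
  obtain ⟨h1, h2, h3, h4, hb⟩ := hP
  obtain ⟨ρ, hρ⟩ := hb.subset_closedBall 0
  filter_upwards [h1.eventually_isRegular hn h3, h2.eventually_isRegular hn h4,
    eventually_ge_atTop ρ] with R hR hR' hRρ
  refine ⟨hR, hR', fun x hx i => ?_⟩
  have h5 := mem_closedBall_zero_iff.1 (hρ hx)
  exact ((le_abs_self _).trans (norm_le_pi_norm x i)).trans (h5.trans hRρ)

lemma orthantPairs_subset (hn : 0 < n) : orthantPairs n ⊆ regularPairs n :=
  fun _ hP => (eventually_isRegularPair hn hP).exists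

lemma supportCone_add {A B : Set (Fin n → ℝ)} (hA : A.Nonempty) (hB : B.Nonempty) :
    supportCone (A + B) = supportCone A ∩ supportCone B := by
  ext γ
  simp only [supportCone, Set.mem_inter_iff, Set.mem_ofPred_eq, Set.image_add]
  constructor
  · rintro ⟨m, hm⟩
    obtain ⟨a, ha⟩ := hA
    obtain ⟨b, hb⟩ := hB
    constructor
    · refine ⟨m - γ b, ?_⟩
      rintro _ ⟨x, hx, rfl⟩
      have := hm (Set.add_mem_add (Set.mem_image_of_mem γ hx) (Set.mem_image_of_mem γ hb))
      linarith
    · refine ⟨m - γ a, ?_⟩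
      rintro _ ⟨x, hx, rfl⟩
      have := hm (Set.add_mem_add (Set.mem_image_of_mem γ ha) (Set.mem_image_of_mem γ hx))
      linarith
  · rintro ⟨h1, h2⟩
    exact h1.add h2

lemma add_mem_orthantPairs (hn : 0 < n) {P Q : Set (Fin n → ℝ) × Set (Fin n → ℝ)}
    (hP : P ∈ orthantPairs n) (hQ : Q ∈ orthantPairs n) : P + Q ∈ orthantPairs n := by
  obtain ⟨R, hR⟩ := (eventually_isRegularPair hn hP).exists
  obtain ⟨R', hR'⟩ := (eventually_isRegularPair hn hQ).exists
  obtain ⟨h1, h2, h3, h4, -⟩ := hP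
  obtain ⟨h1', h2', h3', h4', -⟩ := hQ
  have h5 : supportCone (P + Q).1 = supportCone (orthant n) := by
    rw [Prod.fst_add, supportCone_add (nonempty_of_supportCone hn h3)
      (nonempty_of_supportCone hn h3'), h3, h3', Set.inter_self]
  have h6 : supportCone (P + Q).2 = supportCone (orthant n) := by
    rw [Prod.snd_add, supportCone_add (nonempty_of_supportCone hn h4)
      (nonempty_of_supportCone hn h4'), h4, h4', Set.inter_self]
  refine ⟨h1.add h1', h2.add h2', h5, h6, ?_⟩
  refine ((isBounded_inter_lowerOrthant h5 (R + R')).union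
    (isBounded_inter_lowerOrthant h6 (R + R'))).subset fun x hx => ?_
  have hx' := (hR.add hR').symmDiff_subset hx
  rcases hx with hx | hx
  · exact Or.inl ⟨hx.1, hx'⟩
  · exact Or.inr ⟨hx.1, hx'⟩

lemma orthant_pair_mem : (orthant n, orthant n) ∈ orthantPairs n :=
  ⟨isPolyhedron_orthant, isPolyhedron_orthant, rfl, rfl, by simp⟩

/-- Sets with bounded symmetric difference have the same support cone. -/
lemma supportCone_eq_of_isBounded_symmDiff {A B : Set (Fin n → ℝ)}
    (h : Bornology.IsBounded (symmDiff A B)) : supportCone A = supportCone B := by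
  have key : ∀ {A B : Set (Fin n → ℝ)}, Bornology.IsBounded (symmDiff A B) →
      supportCone A ⊆ supportCone B := by
    intro A B h γ hγ
    have h1 : BddBelow (γ '' symmDiff A B) :=
      ((LinearMap.toContinuousLinearMap γ).lipschitz.isBounded_image h).bddBelow
    refine ((hγ : BddBelow (γ '' A)).union h1).mono ?_
    rw [← Set.image_union]
    refine Set.image_mono fun x hx => ?_
    by_cases hxA : x ∈ A
    · exact Or.inl hxA
    · exact Or.inr (Or.inr ⟨hx, hxA⟩)
  exact (key h).antisymm (key (by rwa [symmDiff_comm]))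

lemma orthant_mk_mem {B : Set (Fin n → ℝ)} (hB : IsPolyhedron B)
    (hb : Bornology.IsBounded (symmDiff (orthant n) B)) : (orthant n, B) ∈ orthantPairs n :=
  ⟨isPolyhedron_orthant, hB, rfl, (supportCone_eq_of_isBounded_symmDiff hb).symm, hb⟩

lemma isMixedVolume_relMixedVolume (hn : 0 < n) :
    IsMixedVolume (supportCone (orthant n)) (relMixedVolume (n := n)) where
  symmetric P _ σ := relMixedVolume_comp_perm P σ
  additive P hP i Q hQ R hR := additiveOn_relMixedVolume hn P
    (fun i => orthantPairs_subset hn (hP i)) i Q (orthantPairs_subset hn hQ) R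
    (orthantPairs_subset hn hR)
  diagonal _ hP := relMixedVolume_const hn (orthantPairs_subset hn hP)

/-- A mixed volume is determined by the volumes of the pairs: polarization with an arbitrary base
point `X`. -/
lemma IsMixedVolume.altSum_pairVolume (hn : 0 < n)
    {MV : (Fin n → Set (Fin n → ℝ) × Set (Fin n → ℝ)) → ℝ}
    (h : IsMixedVolume (supportCone (orthant n)) MV)
    {X : Set (Fin n → ℝ) × Set (Fin n → ℝ)} (hX : X ∈ orthantPairs n)
    (P : Fin n → Set (Fin n → ℝ) × Set (Fin n → ℝ)) (hP : ∀ i, P i ∈ orthantPairs n) :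
    altSum (fun S => pairVolume (X + ∑ i ∈ S, P i)) = n.factorial * MV P := by
  have hM : ∀ a ∈ orthantPairs n, ∀ b ∈ orthantPairs n, a + b ∈ orthantPairs n :=
    fun _ ha _ hb => add_mem_orthantPairs hn ha hb
  have hF : AdditiveOn (orthantPairs n) MV := h.additive
  have h1 := hF.altSum_map_const hM hX P hP
  have h2 : ∀ S : Finset (Fin n), X + ∑ i ∈ S, P i ∈ orthantPairs n := by
    intro S
    rcases S.eq_empty_or_nonempty with rfl | hS
    · simpa using hX
    · exact hM _ hX _ (sum_mem_of_nonempty hM P hP hS)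
  simp only [h.diagonal _ (h2 _), h.symmetric P hP] at h1
  rw [h1]
  simp [Fintype.card_perm]

/-! ### Corners of the orthant -/

/-- The part `w ⬝ᵥ x ≥ c` of the orthant. For positive `w` its complement in the orthant is a
simplex. -/
def cutOrthant (w : Fin n → ℝ) (c : ℝ) : Set (Fin n → ℝ) :=
  orthant n ∩ {x | c ≤ w ⬝ᵥ x}

lemma isUpperSet_orthant : IsUpperSet (orthant n) := fun _ _ hxy hx i => (hx i).trans (hxy i)

lemma add_mem_orthant {x y : Fin n → ℝ} (hx : x ∈ orthant n) (hy : y ∈ orthant n) :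
    x + y ∈ orthant n := fun i => add_nonneg (hx i) (hy i)

lemma orthant_add_of_isUpperSet {A : Set (Fin n → ℝ)} (hA : IsUpperSet A) : orthant n + A = A := by
  ext x
  constructor
  · rintro ⟨c, hc, a, ha, rfl⟩
    exact hA (le_add_of_nonneg_left hc) ha
  · intro hx
    exact ⟨0, fun _ => le_rfl, x, hx, zero_add x⟩

lemma isPolyhedron_cutOrthant (w : Fin n → ℝ) (c : ℝ) : IsPolyhedron (cutOrthant w c) := by
  refine IsPolyhedral.inter isPolyhedron_orthant ⟨{((dotCLM w).toLinearMap, c)}, ?_⟩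
  ext x
  simp

lemma cutOrthant_mem_orthantPairs {w : Fin n → ℝ} (hw : ∀ i, 0 < w i) (c : ℝ) :
    (orthant n, cutOrthant w c) ∈ orthantPairs n := by
  refine orthant_mk_mem (isPolyhedron_cutOrthant w c) ?_
  refine (Metric.isBounded_Icc (0 : Fin n → ℝ) (fun i => c / w i)).subset ?_
  rintro x (⟨hx, hxc⟩ | ⟨hx, hxc⟩)
  · refine ⟨hx, fun i => ?_⟩
    have h1 : w ⬝ᵥ x < c := by
      by_contra! h
      exact hxc ⟨hx, h⟩
    rw [le_div_iff₀ (hw i), mul_comm]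
    exact (Finset.single_le_sum (f := fun i => w i * x i)
      (fun j _ => mul_nonneg (hw j).le (hx j)) (Finset.mem_univ i)).trans h1.le
  · exact absurd hx.1 hxc

lemma isUpperSet_cutOrthant {w : Fin n → ℝ} (hw : ∀ i, 0 < w i) (c : ℝ) :
    IsUpperSet (cutOrthant w c) := fun _ _ hxy hx =>
  ⟨isUpperSet_orthant hxy hx.1, le_trans (show c ≤ _ from hx.2)
    (Finset.sum_le_sum fun i _ => mul_le_mul_of_nonneg_left (hxy i) (hw i).le)⟩

/-! ### Slices in the direction of the first coordinate -/

/-- The volume of the complement in the orthant. -/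
noncomputable def covolume (A : Set (Fin n → ℝ)) : ℝ := volume.real (orthant n \ A)

lemma pairVolume_orthant {A : Set (Fin n → ℝ)} (hA : A ⊆ orthant n) :
    pairVolume (orthant n, A) = n.factorial * covolume A := by
  simp [pairVolume, covolume, Set.sdiff_eq_empty.2 hA]

/-- Slice of `A` by a hyperplane on which the first coordinate is constant. -/
def slice (s : ℝ) (A : Set (Fin (n + 1) → ℝ)) : Set (Fin n → ℝ) :=
  {x | (Fin.cons s x : Fin (n + 1) → ℝ) ∈ A}

lemma integrable_slice {G : Set (Fin (n + 1) → ℝ)} (hG : MeasurableSet G)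
    (hfin : volume G ≠ ⊤) :
    Integrable (fun s => volume.real (slice s G)) ∧
      ∫ s, volume.real (slice s G) = volume.real G := by
  have he := (volume_preserving_piFinSuccAbove (fun _ : Fin (n + 1) => ℝ) 0).symm
  set e := MeasurableEquiv.piFinSuccAbove (fun _ : Fin (n + 1) => ℝ) 0
  have hvol : (volume.prod volume) (e.symm ⁻¹' G) = volume G :=
    he.measure_preimage hG.nullMeasurableSet
  have hm : MeasurableSet (e.symm ⁻¹' G) := e.symm.measurable hG
  have hsl : ∀ s, Prod.mk s ⁻¹' (e.symm ⁻¹' G) = slice s G := by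
    intro s
    ext x
    simp only [Set.mem_preimage, slice, Set.mem_ofPred_eq]
    rw [← Fin.insertNth_zero']
    rfl
  have hfin' : (volume.prod volume) (e.symm ⁻¹' G) ≠ ⊤ := by rwa [hvol]
  have hi := Measure.integrable_measure_prodMk_left hm hfin'
  simp only [hsl] at hi
  refine ⟨hi, ?_⟩
  have h1 := Measure.prod_apply (μ := (volume : Measure ℝ))
    (ν := (volume : Measure (Fin n → ℝ))) hm
  rw [hvol] at h1
  simp only [hsl] at h1
  have h2 : AEMeasurable (fun s => volume (slice s G)) := by
    have := measurable_measure_prodMk_left (ν := (volume : Measure (Fin n → ℝ))) hm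
    simp only [hsl] at this
    exact this.aemeasurable
  simp only [Measure.real]
  rw [h1, integral_toReal h2 (ae_lt_top' h2 (by rw [← h1]; exact hfin))]

lemma slice_diff (s : ℝ) (A B : Set (Fin (n + 1) → ℝ)) :
    slice s (A \ B) = slice s A \ slice s B := rfl

lemma cons_mem_orthant {s : ℝ} {x : Fin n → ℝ} :
    (Fin.cons s x : Fin (n + 1) → ℝ) ∈ orthant (n + 1) ↔ 0 ≤ s ∧ x ∈ orthant n := by
  simp [orthant, Fin.forall_fin_succ]

lemma slice_orthant {s : ℝ} (hs : 0 ≤ s) : slice s (orthant (n + 1)) = orthant n := by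
  ext x
  exact cons_mem_orthant.trans (and_iff_right hs)

lemma slice_orthant_of_neg {s : ℝ} (hs : s < 0) : slice s (orthant (n + 1)) = ∅ := by
  ext x
  exact iff_of_false (fun h => absurd (cons_mem_orthant.1 h).1 (not_le.2 hs)) id

/-- The upper subsets of the orthant that are closed under moving mass from the first coordinate to
the others at the exchange rate `ε`, as long as the first coordinate stays nonnegative. -/
structure IsSlidable (ε : ℝ) (A : Set (Fin (n + 1) → ℝ)) : Prop where
  subset : A ⊆ orthant (n + 1)
  upper : IsUpperSet A
  slide : ∀ a ∈ A, ∀ y : Fin n → ℝ, 0 ≤ y → ε * ∑ j, y j ≤ a 0 →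
    a + (Fin.cons (-(ε * ∑ j, y j)) y : Fin (n + 1) → ℝ) ∈ A

lemma isSlidable_orthant (ε : ℝ) : IsSlidable ε (orthant (n + 1)) := by
  refine ⟨subset_rfl, isUpperSet_orthant, fun a ha y hy h => ?_⟩
  intro i
  refine Fin.cases ?_ (fun j => ?_) i
  · simpa using h
  · simpa using add_nonneg (ha j.succ) (hy j)

lemma exists_split {ε : ℝ} {y : Fin n → ℝ} (hy : 0 ≤ y) {a b : ℝ} (ha : 0 ≤ a)
    (hb : 0 ≤ b) (h : ε * ∑ j, y j ≤ a + b) :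
    ∃ y₁ y₂ : Fin n → ℝ, 0 ≤ y₁ ∧ 0 ≤ y₂ ∧ y = y₁ + y₂ ∧ ε * ∑ j, y₁ j ≤ a ∧
      ε * ∑ j, y₂ j ≤ b := by
  rcases (add_nonneg ha hb).eq_or_lt with h0 | h0
  · refine ⟨y, 0, hy, le_rfl, by simp, by linarith, by simpa using hb⟩
  · have h1 : ∀ c, 0 ≤ c → ε * ∑ j, ((c / (a + b)) • y) j ≤ c := by
      intro c hc
      simp only [Pi.smul_apply, smul_eq_mul, ← Finset.mul_sum]
      calc ε * (c / (a + b) * ∑ j, y j) = c / (a + b) * (ε * ∑ j, y j) := by ring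
        _ ≤ c / (a + b) * (a + b) := by gcongr
        _ = c := div_mul_cancel₀ _ h0.ne'
    refine ⟨(a / (a + b)) • y, (b / (a + b)) • y, smul_nonneg (by positivity) hy,
      smul_nonneg (by positivity) hy, ?_, h1 a ha, h1 b hb⟩
    rw [← add_smul, ← add_div, div_self h0.ne', one_smul]

lemma IsSlidable.add {ε : ℝ} {A B : Set (Fin (n + 1) → ℝ)} (hA : IsSlidable ε A)
    (hB : IsSlidable ε B) : IsSlidable ε (A + B) where
  subset := by
    rintro _ ⟨a, ha, b, hb, rfl⟩
    exact add_mem_orthant (hA.subset ha) (hB.subset hb)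
  upper := by
    rintro _ y hxy ⟨a, ha, b, hb, rfl⟩
    refine ⟨a + (y - (a + b)), hA.upper (le_add_of_nonneg_right (sub_nonneg.2 hxy)) ha, b, hb, ?_⟩
    simp only
    abel
  slide := by
    rintro _ ⟨a, ha, b, hb, rfl⟩ y hy h
    obtain ⟨y₁, y₂, h1, h2, rfl, h3, h4⟩ := exists_split hy (hA.subset ha 0) (hB.subset hb 0) h
    refine ⟨_, hA.slide a ha y₁ h1 h3, _, hB.slide b hb y₂ h2 h4, ?_⟩
    ext i
    refine Fin.cases ?_ (fun j => ?_) i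
    · simp only [Pi.add_apply, Fin.cons_zero, Finset.sum_add_distrib]
      ring
    · simp only [Pi.add_apply, Fin.cons_succ]
      ring

lemma slice_zero_add {A B : Set (Fin (n + 1) → ℝ)} (hA : A ⊆ orthant (n + 1))
    (hB : B ⊆ orthant (n + 1)) : slice 0 (A + B) = slice 0 A + slice 0 B := by
  ext x
  constructor
  · rintro ⟨a, ha, b, hb, hab⟩
    have hab : a + b = Fin.cons 0 x := hab
    have h0 : a 0 + b 0 = 0 := by simpa using congrFun hab 0
    have ha0 : a 0 = 0 := by linarith [hA ha 0, hB hb 0]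
    have hb0 : b 0 = 0 := by linarith [hA ha 0, hB hb 0]
    refine ⟨Fin.tail a, ?_, Fin.tail b, ?_, ?_⟩
    · change (Fin.cons 0 (Fin.tail a) : Fin (n + 1) → ℝ) ∈ A
      rwa [← ha0, Fin.cons_self_tail]
    · change (Fin.cons 0 (Fin.tail b) : Fin (n + 1) → ℝ) ∈ B
      rwa [← hb0, Fin.cons_self_tail]
    · ext j
      simpa [Fin.tail] using congrFun hab j.succ
  · rintro ⟨a, ha, b, hb, rfl⟩
    refine ⟨_, ha, _, hb, ?_⟩
    ext i
    refine Fin.cases ?_ (fun j => ?_) i <;> simp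

/-- The weights of the simplex with vertices `0`, `e_j` and `ε⁻¹ e_k` for `k ≠ j`. -/
def spike (ε : ℝ) (j : Fin n) : Fin n → ℝ := fun k => if k = j then 1 else ε

lemma spike_pos {ε : ℝ} (hε : 0 < ε) (j k : Fin n) : 0 < spike ε j k := by
  unfold spike
  split_ifs
  · exact one_pos
  · exact hε

lemma mem_cutOrthant_spike_zero {ε c : ℝ} {d : Fin (n + 1) → ℝ} :
    d ∈ cutOrthant (spike ε 0) c ↔
      d ∈ orthant (n + 1) ∧ c ≤ d 0 + ε * ∑ j : Fin n, d j.succ := by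
  simp [cutOrthant, spike, dotProduct, Fin.sum_univ_succ, Finset.mul_sum]

lemma slice_add_of_lt {ε : ℝ} {A : Set (Fin (n + 1) → ℝ)} (hA : IsSlidable ε A) {s : ℝ}
    (hs0 : 0 ≤ s) (hs1 : s < 1) :
    slice s (cutOrthant (spike ε 0) 1 + A) =
      cutOrthant (fun _ => ε) (1 - s) + slice 0 A := by
  ext x
  constructor
  · rintro ⟨d, hd, a, ha, hda⟩
    have hda : d + a = Fin.cons s x := hda
    obtain ⟨hd, hd1⟩ := mem_cutOrthant_spike_zero.1 hd
    have h0 : d 0 + a 0 = s := by simpa using congrFun hda 0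
    have ha0 := hA.subset ha 0
    set t := ε * ∑ j : Fin n, d j.succ with ht
    have htpos : 0 < t := by linarith
    -- slide the first coordinate of `a` away, at the expense of the tail of `d`
    set y : Fin n → ℝ := (a 0 / t) • Fin.tail d with hy
    have hy0 : 0 ≤ y := smul_nonneg (by positivity) fun j => hd j.succ
    have hyd : y ≤ Fin.tail d := by
      intro j
      have : a 0 / t ≤ 1 := by rw [div_le_one htpos]; linarith
      simpa [hy, Fin.tail] using mul_le_mul_of_nonneg_right this (hd j.succ)
    have hysum : ε * ∑ j, y j = a 0 := by
      simp only [hy, Pi.smul_apply, smul_eq_mul, ← Finset.mul_sum, Fin.tail]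
      rw [mul_left_comm, ← ht, div_mul_cancel₀ _ htpos.ne']
    have hslide := hA.slide a ha y hy0 hysum.le
    refine ⟨Fin.tail d - y, ⟨fun j => sub_nonneg.2 (hyd j), ?_⟩, Fin.tail a + y, ?_, ?_⟩
    · simp only [Set.mem_ofPred_eq, dotProduct, ← Finset.mul_sum, Pi.sub_apply,
        Finset.sum_sub_distrib, mul_sub, hysum, Fin.tail, ← ht]
      linarith
    · change (Fin.cons 0 (Fin.tail a + y) : Fin (n + 1) → ℝ) ∈ A
      convert hslide using 1
      ext i
      refine Fin.cases ?_ (fun j => ?_) i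
      · simp [hysum]
      · simp [Fin.tail]
    · ext j
      have := congrFun hda j.succ
      simp only [Pi.add_apply, Fin.cons_succ, Pi.sub_apply, Fin.tail] at this ⊢
      linarith
  · rintro ⟨d, ⟨hd, hd1⟩, a, ha, rfl⟩
    refine ⟨Fin.cons s d, mem_cutOrthant_spike_zero.2 ⟨cons_mem_orthant.2 ⟨hs0, hd⟩, ?_⟩, _, ha, ?_⟩
    · simp only [Set.mem_ofPred_eq, dotProduct, ← Finset.mul_sum] at hd1
      simp only [Fin.cons_zero, Fin.cons_succ]
      linarith
    · ext i
      refine Fin.cases ?_ (fun j => ?_) i <;> simp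

lemma slice_add_of_le {ε : ℝ} {A : Set (Fin (n + 1) → ℝ)} (hA : IsSlidable ε A) {s : ℝ}
    (hs1 : 1 ≤ s) : slice s (cutOrthant (spike ε 0) 1 + A) = slice (s - 1) A := by
  ext x
  constructor
  · rintro ⟨d, hd, a, ha, hda⟩
    have hda : d + a = Fin.cons s x := hda
    obtain ⟨hd, hd1⟩ := mem_cutOrthant_spike_zero.1 hd
    have h0 : d 0 + a 0 = s := by simpa using congrFun hda 0
    have hx : ∀ j : Fin n, d j.succ + a j.succ = x j := fun j => by
      simpa using congrFun hda j.succ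
    rcases le_or_gt 1 (d 0) with hd0 | hd0
    · refine hA.upper ?_ ha
      intro i
      refine Fin.cases ?_ (fun j => ?_) i
      · simp only [Fin.cons_zero]; linarith
      · simp only [Fin.cons_succ]; linarith [hx j, hd j.succ]
    · set t := ε * ∑ j : Fin n, d j.succ with ht
      have htpos : 0 < t := by linarith
      set y : Fin n → ℝ := ((1 - d 0) / t) • Fin.tail d with hy
      have hy0 : 0 ≤ y := smul_nonneg (div_nonneg (by linarith) htpos.le) fun j => hd j.succ
      have hyd : y ≤ Fin.tail d := by
        intro j
        have : (1 - d 0) / t ≤ 1 := by rw [div_le_one htpos]; linarith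
        simpa [hy, Fin.tail] using mul_le_mul_of_nonneg_right this (hd j.succ)
      have hysum : ε * ∑ j, y j = 1 - d 0 := by
        simp only [hy, Pi.smul_apply, smul_eq_mul, ← Finset.mul_sum, Fin.tail]
        rw [mul_left_comm, ← ht, div_mul_cancel₀ _ htpos.ne']
      refine hA.upper ?_ (hA.slide a ha y hy0 (by rw [hysum]; linarith))
      intro i
      refine Fin.cases ?_ (fun j => ?_) i
      · simp only [Pi.add_apply, Fin.cons_zero, hysum]; linarith
      · have := hyd j
        simp only [Fin.tail] at this
        simp only [Pi.add_apply, Fin.cons_succ]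
        linarith [hx j]
  · intro hx
    refine ⟨Pi.single 0 1, mem_cutOrthant_spike_zero.2 ⟨?_, ?_⟩, _, hx, ?_⟩
    · intro i
      refine Fin.cases ?_ (fun j => ?_) i <;> simp
    · simp
    · ext i
      refine Fin.cases ?_ (fun j => ?_) i <;> simp

lemma measurableSet_orthant_diff {A : Set (Fin n → ℝ)} (hA : (orthant n, A) ∈ orthantPairs n) :
    MeasurableSet (orthant n \ A) :=
  isPolyhedron_orthant.isClosed.measurableSet.diff hA.2.1.isClosed.measurableSet

lemma volume_orthant_diff_ne_top {A : Set (Fin n → ℝ)} (hA : (orthant n, A) ∈ orthantPairs n) :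
    volume (orthant n \ A) ≠ ⊤ :=
  (hA.2.2.2.2.subset fun _ hx => Or.inl hx).measure_lt_top.ne

/-- Fubini in the direction of the first coordinate: in the complement, adding
`cutOrthant (spike ε 0) 1` to `A` shifts the slices up by one and inserts new slices at the levels
below one. -/
lemma covolume_cutOrthant_add {ε : ℝ} (hε : 0 < ε) {A : Set (Fin (n + 1) → ℝ)}
    (hA : IsSlidable ε A) (hAm : (orthant (n + 1), A) ∈ orthantPairs (n + 1)) :
    IntegrableOn (fun s => covolume (cutOrthant (fun _ : Fin n => ε) (1 - s) + slice 0 A))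
      (Set.Ico 0 1) ∧
    covolume (cutOrthant (spike ε 0) 1 + A) - covolume A =
      ∫ s in Set.Ico (0 : ℝ) 1, covolume (cutOrthant (fun _ : Fin n => ε) (1 - s) + slice 0 A) := by
  have hDm : (orthant (n + 1), cutOrthant (spike ε 0) 1 + A) ∈ orthantPairs (n + 1) := by
    have := add_mem_orthantPairs n.succ_pos (cutOrthant_mem_orthantPairs (spike_pos hε 0) 1) hAm
    rwa [Prod.mk_add_mk, orthant_add_of_isUpperSet isUpperSet_orthant] at this
  obtain ⟨h1, h1'⟩ := integrable_slice (measurableSet_orthant_diff hAm)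
    (volume_orthant_diff_ne_top hAm)
  obtain ⟨h2, h2'⟩ := integrable_slice (measurableSet_orthant_diff hDm)
    (volume_orthant_diff_ne_top hDm)
  set h : ℝ → ℝ := fun s => covolume (cutOrthant (fun _ : Fin n => ε) (1 - s) + slice 0 A) with hh
  set g : ℝ → ℝ := fun s => volume.real (slice s (orthant (n + 1) \ A)) with hg
  set g' : ℝ → ℝ := fun s =>
    volume.real (slice s (orthant (n + 1) \ (cutOrthant (spike ε 0) 1 + A))) with hg'
  have hgneg : ∀ s < 0, g s = 0 := fun s hs => by
    simp [hg, slice_diff, slice_orthant_of_neg hs]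
  have key : ∀ s, (Set.Ico (0 : ℝ) 1).indicator h s = g' s - g (s - 1) := by
    intro s
    rcases lt_or_ge s 0 with hs | hs
    · rw [Set.indicator_of_notMem (fun hc => absurd hc.1 (not_le.2 hs)), hgneg _ (by linarith)]
      simp [hg', slice_diff, slice_orthant_of_neg hs]
    · rcases lt_or_ge s 1 with hs1 | hs1
      · rw [Set.indicator_of_mem (show s ∈ Set.Ico (0 : ℝ) 1 from ⟨hs, hs1⟩), hgneg _ (by linarith), sub_zero]
        simp only [hh, hg', slice_diff, slice_add_of_lt hA hs hs1, slice_orthant hs, covolume]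
      · rw [Set.indicator_of_notMem (fun hc => absurd hc.2 (not_lt.2 hs1))]
        simp only [hg, hg', slice_diff, slice_add_of_le hA hs1, slice_orthant hs,
          slice_orthant (sub_nonneg.2 hs1), sub_self]
  have hint : Integrable ((Set.Ico (0 : ℝ) 1).indicator h) := by
    rw [funext key]
    exact h2.sub (h1.comp_sub_right 1)
  refine ⟨(integrable_indicator_iff measurableSet_Ico).1 hint, ?_⟩
  rw [← integral_indicator measurableSet_Ico, funext key, integral_sub h2 (h1.comp_sub_right 1),
    integral_sub_right_eq_self g 1, h1', h2']
  rfl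

lemma altSum_succ (f : Finset (Fin (n + 1)) → ℝ) :
    altSum f = altSum (fun S : Finset (Fin n) =>
      f (insert 0 (S.map (Fin.succEmb n))) - f (S.map (Fin.succEmb n))) := by
  have huniv : (Finset.univ : Finset (Finset (Fin (n + 1)))) =
      (insert 0 (Finset.univ.map (Fin.succEmb n))).powerset := by
    rw [← Finset.powerset_univ]
    congr 1
    ext i
    refine Fin.cases ?_ (fun j => ?_) i <;> simp
  have h0 : (0 : Fin (n + 1)) ∉ (Finset.univ : Finset (Fin n)).map (Fin.succEmb n) := by simp
  unfold altSum
  rw [huniv, Finset.sum_powerset_insert h0, ← Finset.sum_add_distrib]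
  symm
  refine Finset.sum_bij (fun S _ => S.map (Fin.succEmb n)) ?_ ?_ ?_ ?_
  · intro S _
    exact Finset.mem_powerset.2 (Finset.map_subset_map.2 (Finset.subset_univ S))
  · intro S _ T _ h
    exact Finset.map_injective _ h
  · intro U hU
    obtain ⟨S, -, hS⟩ := Finset.subset_map_iff.1 (Finset.mem_powerset.1 hU)
    exact ⟨S, Finset.mem_univ _, hS.symm⟩
  · intro S _
    have h1 : (0 : Fin (n + 1)) ∉ S.map (Fin.succEmb n) := by simp
    have h2 : S.card ≤ n := by simpa using Finset.card_le_univ S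
    rw [Finset.card_insert_of_notMem h1, Finset.card_map, show n + 1 - (S.card + 1) = n - S.card by omega,
      show n + 1 - S.card = n - S.card + 1 by omega, pow_succ]
    ring

/-- Reduction of the dimension: a relative mixed volume with `cutOrthant (spike ε 0) 1` as its first
argument is a relative mixed volume of slices at level zero. -/
lemma relMixedVolume_cons (hn : 0 < n) {ε : ℝ} (hε : 0 < ε)
    {B : Fin n → Set (Fin (n + 1) → ℝ)} (hB : ∀ i, IsSlidable ε (B i))
    (hBm : ∀ i, (orthant (n + 1), B i) ∈ orthantPairs (n + 1))
    (hBs : ∀ i, (orthant n, slice 0 (B i)) ∈ orthantPairs n) :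
    relMixedVolume (Fin.cons (orthant (n + 1), cutOrthant (spike ε 0) 1)
        fun i => (orthant (n + 1), B i)) =
      relMixedVolume (fun i => (orthant n, slice 0 (B i))) := by
  set P : Fin (n + 1) → Set (Fin (n + 1) → ℝ) × Set (Fin (n + 1) → ℝ) :=
    Fin.cons (orthant (n + 1), cutOrthant (spike ε 0) 1) fun i => (orthant (n + 1), B i) with hP
  have hD := cutOrthant_mem_orthantPairs (spike_pos hε (0 : Fin (n + 1))) 1
  have hPm : ∀ i, P i ∈ orthantPairs (n + 1) := by
    intro i
    refine Fin.cases ?_ (fun j => ?_) i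
    · exact hD
    · exact hBm j
  have hsum : ∀ S : Finset (Fin n), ∃ A : Set (Fin (n + 1) → ℝ), IsSlidable ε A ∧
      (orthant (n + 1), A) ∈ orthantPairs (n + 1) ∧
      (orthant (n + 1), orthant (n + 1)) + ∑ i ∈ S, P i.succ = (orthant (n + 1), A) ∧
      ∀ X : Set (Fin n → ℝ), IsUpperSet X → X ⊆ orthant n →
        (orthant n, X) + ∑ i ∈ S, (orthant n, slice 0 (B i)) = (orthant n, X + slice 0 A) ∧
        X + slice 0 A ⊆ orthant n := by
    intro S
    induction S using Finset.induction_on with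
    | empty =>
      refine ⟨orthant (n + 1), isSlidable_orthant ε, orthant_pair_mem, by simp, fun X hX hX' => ?_⟩
      rw [slice_orthant le_rfl, add_comm X, orthant_add_of_isUpperSet hX]
      exact ⟨by simp, hX'⟩
    | insert i S hi ih =>
      obtain ⟨A, h1, h2, h3, h4⟩ := ih
      have hC : orthant (n + 1) + orthant (n + 1) = orthant (n + 1) :=
        orthant_add_of_isUpperSet isUpperSet_orthant
      have hC' : orthant n + orthant n = orthant n := orthant_add_of_isUpperSet isUpperSet_orthant
      refine ⟨B i + A, (hB i).add h1, ?_, ?_, fun X hX hX' => ?_⟩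
      · have := add_mem_orthantPairs n.succ_pos (hBm i) h2
        rwa [Prod.mk_add_mk, hC] at this
      · rw [Finset.sum_insert hi, add_left_comm, h3]
        simp [hP, hC]
      · obtain ⟨h5, h6⟩ := h4 X hX hX'
        have h7 : slice 0 (B i) ⊆ orthant n := fun x hx =>
          (cons_mem_orthant.1 ((hB i).subset hx)).2
        rw [Finset.sum_insert hi, add_left_comm, h5, slice_zero_add (hB i).subset h1.subset,
          Prod.mk_add_mk, hC', add_left_comm X]
        refine ⟨rfl, ?_⟩
        rintro _ ⟨b, hb, y, hy, rfl⟩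
        exact add_mem_orthant (h7 hb) (h6 hy)
  choose A hA1 hA2 hA3 hA4 using hsum
  have hMV := (isMixedVolume_relMixedVolume n.succ_pos).altSum_pairVolume n.succ_pos
    orthant_pair_mem P hPm
  have hDsub : cutOrthant (spike ε (0 : Fin (n + 1))) 1 ⊆ orthant (n + 1) := fun x hx => hx.1
  have hstep : ∀ S : Finset (Fin n),
      pairVolume ((orthant (n + 1), orthant (n + 1)) +
          ∑ i ∈ insert 0 (S.map (Fin.succEmb n)), P i) -
        pairVolume ((orthant (n + 1), orthant (n + 1)) + ∑ i ∈ S.map (Fin.succEmb n), P i) =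
      (n + 1).factorial * ∫ s in Set.Ico (0 : ℝ) 1,
        covolume (cutOrthant (fun _ : Fin n => ε) (1 - s) + slice 0 (A S)) := by
    intro S
    have h0 : (0 : Fin (n + 1)) ∉ S.map (Fin.succEmb n) := by simp
    rw [Finset.sum_insert h0, Finset.sum_map]
    simp only [Fin.coe_succEmb]
    rw [add_left_comm, hA3 S]
    have hP0 : P 0 = (orthant (n + 1), cutOrthant (spike ε 0) 1) := rfl
    rw [hP0, Prod.mk_add_mk, orthant_add_of_isUpperSet isUpperSet_orthant,
      pairVolume_orthant (hA1 S).subset, pairVolume_orthant,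
      ← (covolume_cutOrthant_add hε (hA1 S) (hA2 S)).2, mul_sub]
    rintro _ ⟨b, hb, y, hy, rfl⟩
    exact add_mem_orthant (hDsub hb) ((hA1 S).subset hy)
  rw [altSum_succ] at hMV
  simp only [hstep] at hMV
  rw [altSum_const_mul] at hMV
  have hswap : altSum (fun S : Finset (Fin n) => ∫ s in Set.Ico (0 : ℝ) 1,
        covolume (cutOrthant (fun _ : Fin n => ε) (1 - s) + slice 0 (A S))) =
      ∫ s in Set.Ico (0 : ℝ) 1, altSum (fun S : Finset (Fin n) =>
        covolume (cutOrthant (fun _ : Fin n => ε) (1 - s) + slice 0 (A S))) := by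
    unfold altSum
    rw [integral_finsetSum _ fun S _ =>
      (covolume_cutOrthant_add hε (hA1 S) (hA2 S)).1.const_mul _]
    simp only [integral_const_mul]
  -- the integrand is constant, as polarization works with any base point
  have hconst : ∀ s : ℝ, altSum (fun S : Finset (Fin n) =>
        covolume (cutOrthant (fun _ : Fin n => ε) (1 - s) + slice 0 (A S))) =
      relMixedVolume (fun i => (orthant n, slice 0 (B i))) := by
    intro s
    have h1 := (isMixedVolume_relMixedVolume hn).altSum_pairVolume hn
      (cutOrthant_mem_orthantPairs (fun _ : Fin n => hε) (1 - s)) _ hBs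
    have h2 : ∀ S : Finset (Fin n), pairVolume ((orthant n, cutOrthant (fun _ : Fin n => ε) (1 - s)) +
        ∑ i ∈ S, (orthant n, slice 0 (B i))) =
        n.factorial * covolume (cutOrthant (fun _ : Fin n => ε) (1 - s) + slice 0 (A S)) := by
      intro S
      obtain ⟨h3, h4⟩ := hA4 S _ (isUpperSet_cutOrthant (fun _ : Fin n => hε) (1 - s))
        (fun x hx => hx.1)
      rw [h3, pairVolume_orthant h4]
    simp only [h2] at h1
    rw [altSum_const_mul] at h1
    exact mul_left_cancel₀ (by exact_mod_cast n.factorial_ne_zero) h1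
  rw [hswap] at hMV
  simp only [hconst] at hMV
  have := mul_left_cancel₀ (by exact_mod_cast (n + 1).factorial_ne_zero) hMV
  rw [← this]
  simp

lemma isSlidable_cutOrthant {ε c : ℝ} {w : Fin (n + 1) → ℝ} (hw : ∀ i, 0 < w i)
    (h : ∀ j : Fin n, ε * w 0 ≤ w j.succ) : IsSlidable ε (cutOrthant w c) := by
  refine ⟨fun x hx => hx.1, isUpperSet_cutOrthant hw c, fun a ha y hy hya => ?_⟩
  refine ⟨(isSlidable_orthant ε).slide a ha.1 y hy hya, ?_⟩
  have h1 : c ≤ w ⬝ᵥ a := ha.2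
  simp only [Set.mem_ofPred_eq, dotProduct_add]
  have h2 : w ⬝ᵥ (Fin.cons (-(ε * ∑ j, y j)) y : Fin (n + 1) → ℝ) =
      ∑ j : Fin n, (w j.succ - ε * w 0) * y j := by
    simp only [dotProduct, Fin.sum_univ_succ, Fin.cons_zero, Fin.cons_succ, sub_mul,
      Finset.sum_sub_distrib, ← Finset.mul_sum]
    ring
  rw [h2]
  have h3 : 0 ≤ ∑ j : Fin n, (w j.succ - ε * w 0) * y j :=
    Finset.sum_nonneg fun j _ => mul_nonneg (sub_nonneg.2 (h j)) (hy j)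
  linarith

lemma slice_zero_cutOrthant (w : Fin (n + 1) → ℝ) (c : ℝ) :
    slice 0 (cutOrthant w c) = cutOrthant (Fin.tail w) c := by
  ext x
  simp only [slice, cutOrthant, Set.mem_inter_iff, Set.mem_ofPred_eq, cons_mem_orthant, le_refl,
    true_and, dotProduct, Fin.sum_univ_succ, Fin.cons_zero, Fin.cons_succ, mul_zero, zero_add]
  rfl

/-- For `i ≥ 1` the slice at level zero of the `i`-th set is the set of the same kind in one dimension
less, so the dimension can be reduced step by step. The bound `ε ≤ 1` makes the sets slidable. -/
lemma relMixedVolume_spike {ε : ℝ} (hε : 0 < ε) (hε1 : ε ≤ 1) (n : ℕ) :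
    relMixedVolume (fun i : Fin (n + 1) => (orthant (n + 1), cutOrthant (spike ε i) 1)) = 1 := by
  induction n with
  | zero =>
    have h1 : (fun i : Fin 1 => (orthant 1, cutOrthant (spike ε i) 1)) =
        fun _ => (orthant 1, cutOrthant (spike ε 0) 1) := by
      ext1 i
      rw [Subsingleton.elim i 0]
    rw [h1, relMixedVolume_const one_pos (orthantPairs_subset one_pos
      (cutOrthant_mem_orthantPairs (spike_pos hε 0) 1)), pairVolume_orthant fun x hx => hx.1]
    have h2 : orthant 1 \ cutOrthant (spike ε 0) 1 =
        Set.pi Set.univ fun _ : Fin 1 => Set.Ico (0 : ℝ) 1 := by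
      ext x
      simp only [mem_cutOrthant_spike_zero, orthant, Set.mem_sdiff, Set.mem_ofPred_eq,
        Set.mem_pi, Set.mem_univ, Set.mem_Ico, Fin.forall_fin_one, Finset.univ_eq_empty,
        Finset.sum_empty, mul_zero, add_zero, true_imp_iff, not_and, not_le]
      have h3 : (∀ i : Fin (0 + 1), 0 ≤ x i) ↔ 0 ≤ x 0 := Fin.forall_fin_one
      rw [h3]
      tauto
    rw [covolume, h2, Measure.real, Real.volume_pi_Ico]
    simp
  | succ n ih =>
    have h1 : (fun i : Fin (n + 2) => (orthant (n + 2), cutOrthant (spike ε i) 1)) =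
        Fin.cons (orthant (n + 2), cutOrthant (spike ε 0) 1)
          fun i : Fin (n + 1) => (orthant (n + 2), cutOrthant (spike ε i.succ) 1) := by
      ext1 i
      refine Fin.cases ?_ (fun j => ?_) i <;> rfl
    have h2 : ∀ i : Fin (n + 1), slice 0 (cutOrthant (spike ε i.succ) 1) =
        cutOrthant (spike ε i) 1 := by
      intro i
      rw [slice_zero_cutOrthant]
      congr 1
      ext j
      simp [Fin.tail, spike]
    rw [h1, relMixedVolume_cons n.succ_pos hε]
    · simp only [h2]
      exact ih
    · intro i
      refine isSlidable_cutOrthant (spike_pos hε _) fun j => ?_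
      have h3 : spike ε i.succ 0 = ε := by simp [spike, (Fin.succ_ne_zero i).symm]
      rw [h3]
      unfold spike
      split_ifs <;> nlinarith
    · exact fun i => cutOrthant_mem_orthantPairs (spike_pos hε _) 1
    · intro i
      rw [h2]
      exact cutOrthant_mem_orthantPairs (spike_pos hε _) 1

/-! ### Polyhedra that differ from the orthant by a bounded set -/

lemma isUpperSet_of_isBounded_symmDiff {B : Set (Fin n → ℝ)} (hB : IsPolyhedron B)
    (hb : Bornology.IsBounded (symmDiff (orthant n) B)) : IsUpperSet B :=
  hB.isUpperSet (supportCone_eq_of_isBounded_symmDiff hb).symm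

lemma subset_orthant_of_zero_notMem {B : Set (Fin n → ℝ)} (hB : IsPolyhedron B)
    (hb : Bornology.IsBounded (symmDiff (orthant n) B)) (h0 : (0 : Fin n → ℝ) ∉ B) :
    B ⊆ orthant n := by
  have hup := isUpperSet_of_isBounded_symmDiff hB hb
  intro x hx j
  by_contra! hj
  by_cases hk : ∃ k, k ≠ j
  · -- in dimension at least two, `B` contains an unbounded ray outside of the orthant
    obtain ⟨k, hk⟩ := hk
    obtain ⟨ρ, hρ⟩ := hb.subset_closedBall 0
    set M : ℝ := |x k| + |ρ| + 1 with hM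
    have hMpos : 0 ≤ M := by positivity
    have h1 : x + Pi.single k M ∈ B :=
      hup (le_add_of_nonneg_right (Pi.single_nonneg.2 hMpos)) hx
    have h2 : x + Pi.single k M ∉ orthant n := by
      intro hc
      have := hc j
      simp only [Pi.add_apply, Pi.single_apply, if_neg hk.symm, add_zero] at this
      linarith
    have h3 := mem_closedBall_zero_iff.1 (hρ (Or.inr ⟨h1, h2⟩))
    have h4 := (le_abs_self _).trans ((norm_le_pi_norm (x + Pi.single k M) k).trans h3)
    simp only [Pi.add_apply, Pi.single_eq_same] at h4
    have h5 := neg_abs_le (x k)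
    have h6 := le_abs_self ρ
    linarith
  · push Not at hk
    refine h0 (hup ?_ hx)
    intro i
    rw [hk i]
    exact hj.le

/-- If `B` contains a basis vector `e_j`, then for small `ε` it contains `e_j` and all `ε⁻¹ e_k`,
hence every point `x` of the orthant with `x_j + ε ∑_{k ≠ j} x_k ≥ 1`. -/
lemma eventually_cutOrthant_spike_subset {B : Set (Fin n → ℝ)} (hB : IsPolyhedron B)
    (hb : Bornology.IsBounded (symmDiff (orthant n) B)) {j : Fin n}
    (hj : (Pi.single j 1 : Fin n → ℝ) ∈ B) :
    ∀ᶠ ε : ℝ in 𝓝[>] 0, cutOrthant (spike ε j) 1 ⊆ B := by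
  have hup := isUpperSet_of_isBounded_symmDiff hB hb
  obtain ⟨ρ, hρ⟩ := hb.subset_closedBall 0
  have hlarge : ∀ᶠ ε : ℝ in 𝓝[>] 0, ρ < ε⁻¹ :=
    tendsto_inv_nhdsGT_zero.eventually (eventually_gt_atTop ρ)
  filter_upwards [hlarge, self_mem_nhdsWithin] with ε hε hε0
  have hε0 : 0 < ε := hε0
  have hvert : ∀ k, (Pi.single k (spike ε j k)⁻¹ : Fin n → ℝ) ∈ B := by
    intro k
    by_cases hk : k = j
    · simpa [spike, hk] using hj
    · by_contra hc
      have h1 : (Pi.single k ε⁻¹ : Fin n → ℝ) ∈ symmDiff (orthant n) B := by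
        refine Or.inl ⟨?_, by simpa [spike, hk] using hc⟩
        exact (Pi.single_nonneg.2 (inv_nonneg.2 hε0.le) : (0 : Fin n → ℝ) ≤ _)
      have h2 := mem_closedBall_zero_iff.1 (hρ h1)
      rw [Pi.norm_single, Real.norm_eq_abs] at h2
      exact absurd ((le_abs_self _).trans h2) (not_le.2 hε)
  rintro x ⟨hx, hx1⟩
  set w := spike ε j with hw
  have hwpos : ∀ k, 0 < w k := spike_pos hε0 j
  have hs1 : 1 ≤ w ⬝ᵥ x := hx1
  set s := w ⬝ᵥ x with hs
  have hspos : 0 < s := by linarith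
  have hcomb : s⁻¹ • x = ∑ k, (w k * x k / s) • (Pi.single k (w k)⁻¹ : Fin n → ℝ) := by
    ext i
    have := (hwpos i).ne'
    simp only [Pi.smul_apply, smul_eq_mul, Finset.sum_apply, Pi.single_apply, mul_ite, mul_zero,
      Finset.sum_ite_eq, Finset.mem_univ, if_true]
    field_simp
  have hmem : s⁻¹ • x ∈ B := by
    rw [hcomb]
    refine hB.convex.sum_mem (fun k _ => ?_) ?_ fun k _ => hvert k
    · exact div_nonneg (mul_nonneg (hwpos k).le (hx k)) hspos.le
    · rw [← Finset.sum_div]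
      exact div_self hspos.ne'
  refine hup ?_ hmem
  intro i
  simp only [Pi.smul_apply, smul_eq_mul]
  exact mul_le_of_le_one_left (hx i) (inv_le_one_of_one_le₀ hs1)

/-- A positive functional attains its minimum on a polyhedron in the orthant at a vertex. -/
lemma subset_cutOrthant_of_extremePoints {B : Set (Fin n → ℝ)} (hB : IsPolyhedron B)
    (hBC : B ⊆ orthant n) {w : Fin n → ℝ} (hw : ∀ i, 0 < w i) {c : ℝ}
    (h : ∀ v ∈ B.extremePoints ℝ, c ≤ w ⬝ᵥ v) : B ⊆ cutOrthant w c := by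
  have hcont : Continuous fun y : Fin n → ℝ => w ⬝ᵥ y := continuous_const.dotProduct continuous_id
  have hcomp : ∀ m : ℝ, IsCompact (B ∩ {y | w ⬝ᵥ y ≤ m}) := by
    intro m
    refine Metric.isCompact_of_isClosed_isBounded
      (hB.isClosed.inter (isClosed_le hcont continuous_const)) ?_
    refine (Metric.isBounded_Icc (0 : Fin n → ℝ) (fun i => m / w i)).subset ?_
    rintro y ⟨hy, hym⟩
    refine ⟨hBC hy, fun i => ?_⟩
    rw [le_div_iff₀ (hw i), mul_comm]
    exact (Finset.single_le_sum (f := fun i => w i * y i)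
      (fun j _ => mul_nonneg (hw j).le (hBC hy j)) (Finset.mem_univ i)).trans hym
  intro x hx
  refine ⟨hBC hx, ?_⟩
  obtain ⟨z, ⟨hz, hzx⟩, hmin⟩ := (hcomp (w ⬝ᵥ x)).exists_isMinOn
    ⟨x, hx, show w ⬝ᵥ x ≤ w ⬝ᵥ x from le_rfl⟩ hcont.continuousOn
  have hzx : w ⬝ᵥ z ≤ w ⬝ᵥ x := hzx
  have hzmin : ∀ y ∈ B, w ⬝ᵥ z ≤ w ⬝ᵥ y := by
    intro y hy
    rcases le_total (w ⬝ᵥ y) (w ⬝ᵥ x) with h1 | h1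
    · exact hmin ⟨hy, h1⟩
    · exact hzx.trans h1
  have hface : IsExposed ℝ B (B ∩ {y | w ⬝ᵥ y ≤ w ⬝ᵥ z}) := by
    intro _
    refine ⟨-dotCLM w, ?_⟩
    ext y
    simp only [Set.mem_inter_iff, Set.mem_ofPred_eq, _root_.neg_apply, dotCLM_apply, neg_le_neg_iff]
    exact and_congr_right fun hy => ⟨fun h1 u hu => h1.trans (hzmin u hu), fun h1 => h1 z hz⟩
  obtain ⟨v, hv⟩ := (hcomp (w ⬝ᵥ z)).extremePoints_nonempty
    ⟨z, hz, show w ⬝ᵥ z ≤ w ⬝ᵥ z from le_rfl⟩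
  have hv' := hface.isExtreme.extremePoints_subset_extremePoints hv
  have h1 : w ⬝ᵥ v ≤ w ⬝ᵥ z := (extremePoints_subset hv).2
  exact (h v hv').trans (h1.trans hzx)

/-! ### Scaling of coordinates -/

lemma relMixedVolume_image_linearMap (f : (Fin n → ℝ) →ₗ[ℝ] (Fin n → ℝ))
    (hf : Function.Injective f) (P : Fin n → Set (Fin n → ℝ) × Set (Fin n → ℝ)) :
    relMixedVolume (fun i => (f '' (P i).1, f '' (P i).2)) =
      |LinearMap.det f| * relMixedVolume P := by
  have hsum : ∀ S : Finset (Fin n), ∑ i ∈ S, (f '' (P i).1, f '' (P i).2) =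
      (f '' (∑ i ∈ S, P i).1, f '' (∑ i ∈ S, P i).2) := by
    intro S
    induction S using Finset.induction_on with
    | empty => simp [← Set.singleton_zero, Prod.zero_eq_mk]
    | insert a S ha ih =>
      rw [Finset.sum_insert ha, Finset.sum_insert ha, ih]
      simp [Set.image_add]
  have hvol : ∀ Q : Set (Fin n → ℝ) × Set (Fin n → ℝ),
      pairVolume (f '' Q.1, f '' Q.2) = |LinearMap.det f| * pairVolume Q := by
    intro Q
    have h1 : ∀ s : Set (Fin n → ℝ), volume.real (f '' s) = |LinearMap.det f| * volume.real s := by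
      intro s
      rw [Measure.real, Measure.addHaar_image_linearMap, ENNReal.toReal_mul,
        ENNReal.toReal_ofReal (abs_nonneg _)]
      rfl
    simp only [pairVolume]
    rw [← Set.image_sdiff hf, ← Set.image_sdiff hf, h1, h1]
    ring
  unfold relMixedVolume
  simp only [hsum, hvol, altSum_const_mul]
  ring

lemma image_diagonal_cutOrthant {a : Fin n → ℝ} (ha : ∀ i, 0 < a i) (w : Fin n → ℝ) (c : ℝ) :
    Matrix.toLin' (Matrix.diagonal a) '' cutOrthant w c = cutOrthant (fun i => w i / a i) c := by
  ext x
  constructor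
  · rintro ⟨y, ⟨hy, hyc⟩, rfl⟩
    refine ⟨fun i => ?_, ?_⟩
    · simpa [Matrix.mulVec_diagonal] using mul_nonneg (ha i).le (hy i)
    · refine le_trans (show c ≤ w ⬝ᵥ y from hyc) (le_of_eq ?_)
      refine Finset.sum_congr rfl fun i _ => ?_
      have := (ha i).ne'
      simp only [Matrix.toLin'_apply, Matrix.mulVec_diagonal]
      field_simp
  · rintro ⟨hx, hxc⟩
    refine ⟨fun i => x i / a i, ⟨fun i => div_nonneg (hx i) (ha i).le, ?_⟩, ?_⟩
    · refine le_trans (show c ≤ _ from hxc) (le_of_eq ?_)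
      refine Finset.sum_congr rfl fun i _ => ?_
      ring
    · ext i
      have := (ha i).ne'
      simp only [Matrix.toLin'_apply, Matrix.mulVec_diagonal]
      field_simp

lemma image_diagonal_orthant {a : Fin n → ℝ} (ha : ∀ i, 0 < a i) :
    Matrix.toLin' (Matrix.diagonal a) '' orthant n = orthant n := by
  have h : orthant n = cutOrthant 0 0 := by
    ext x
    simp [cutOrthant]
  have h1 := image_diagonal_cutOrthant ha (0 : Fin n → ℝ) 0
  simp only [Pi.zero_apply, zero_div] at h1
  rw [h]
  exact h1

/-- The weights of the simplex with vertices `0`, `e_j` for `j ∈ J` and `2 e_j` for `j ∉ J`. -/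
noncomputable def halfWeight (J : Finset (Fin n)) : Fin n → ℝ := fun j => if j ∈ J then 1 else 1 / 2

lemma halfWeight_pos (J : Finset (Fin n)) (j : Fin n) : 0 < halfWeight J j := by
  unfold halfWeight
  split_ifs <;> norm_num

lemma relMixedVolume_anti_orthant (hn : 0 < n) {B B' : Fin n → Set (Fin n → ℝ)}
    (hB : ∀ i, (orthant n, B i) ∈ orthantPairs n) (hB' : ∀ i, (orthant n, B' i) ∈ orthantPairs n)
    (h : ∀ i, B i ⊆ B' i) :
    relMixedVolume (fun i => (orthant n, B' i)) ≤ relMixedVolume (fun i => (orthant n, B i)) :=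
  relMixedVolume_anti hn (fun i => eventually_isRegularPair hn (hB i))
    (fun i => eventually_isRegularPair hn (hB' i)) h

lemma relMixedVolume_simplex (hn : 0 < n) :
    relMixedVolume (fun _ : Fin n => (orthant n, cutOrthant (1 : Fin n → ℝ) 1)) = 1 := by
  obtain ⟨m, rfl⟩ := Nat.exists_eq_succ_of_ne_zero hn.ne'
  have h := relMixedVolume_spike one_pos le_rfl m
  have h1 : ∀ i : Fin (m + 1), spike (1 : ℝ) i = 1 := by
    intro i
    ext k
    simp [spike]
  simpa only [h1] using h

/-- Twice the standard set is its sum with itself, so additivity gives a factor two for each index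
in `I`. -/
lemma relMixedVolume_double (hn : 0 < n) (I : Finset (Fin n)) :
    relMixedVolume (fun i : Fin n =>
      (orthant n, cutOrthant (if i ∈ I then (fun _ => 1 / 2) else 1) 1)) = 2 ^ I.card := by
  have hpos : ∀ J : Finset (Fin n), ∀ i k : Fin n,
      0 < (if i ∈ J then (fun _ => 1 / 2) else 1 : Fin n → ℝ) k := by
    intro J i k
    split_ifs <;> norm_num
  have hdouble : (orthant n, cutOrthant (fun _ : Fin n => (1 / 2 : ℝ)) 1) =
      (orthant n, cutOrthant (1 : Fin n → ℝ) 1) + (orthant n, cutOrthant (1 : Fin n → ℝ) 1) := by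
    rw [Prod.mk_add_mk, orthant_add_of_isUpperSet isUpperSet_orthant]
    congr 1
    ext x
    constructor
    · rintro ⟨hx, hx1⟩
      have h1 : (2⁻¹ : ℝ) • x ∈ cutOrthant (1 : Fin n → ℝ) 1 := by
        have hx2 : (1 : ℝ) ≤ (fun _ => 1 / 2) ⬝ᵥ x := hx1
        refine ⟨fun i => mul_nonneg (by norm_num) (hx i),
          show (1 : ℝ) ≤ (1 : Fin n → ℝ) ⬝ᵥ ((2⁻¹ : ℝ) • x) from ?_⟩
        simpa [dotProduct, Finset.mul_sum] using hx2
      exact ⟨_, h1, _, h1, by simp only; rw [← add_smul]; norm_num⟩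
    · rintro ⟨y, ⟨hy, hy1⟩, z, ⟨hz, hz1⟩, rfl⟩
      refine ⟨add_mem_orthant hy hz, ?_⟩
      have h1 : (1 : ℝ) ≤ ∑ i, y i := by simpa [dotProduct] using hy1
      have h2 : (1 : ℝ) ≤ ∑ i, z i := by simpa [dotProduct] using hz1
      simp only [Set.mem_ofPred_eq, dotProduct, ← Finset.mul_sum, Pi.add_apply,
        Finset.sum_add_distrib]
      linarith
  induction I using Finset.induction_on with
  | empty => simpa using relMixedVolume_simplex hn
  | insert a I ha ih =>
    set P : Fin n → Set (Fin n → ℝ) × Set (Fin n → ℝ) := fun i =>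
      (orthant n, cutOrthant (if i ∈ I then (fun _ => 1 / 2) else 1) 1) with hP
    have hPm : ∀ i, P i ∈ orthantPairs n := fun i => cutOrthant_mem_orthantPairs (hpos I i) 1
    have hPa : P a = (orthant n, cutOrthant (1 : Fin n → ℝ) 1) := by simp [hP, ha]
    have h1 : (fun i : Fin n =>
        (orthant n, cutOrthant (if i ∈ insert a I then (fun _ => 1 / 2) else 1) 1)) =
        Function.update P a (P a + P a) := by
      ext1 i
      by_cases hi : i = a
      · subst hi
        rw [Function.update_self, hPa, ← hdouble]
        simp
      · rw [Function.update_of_ne hi]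
        simp [hP, hi]
    rw [h1, (isMixedVolume_relMixedVolume hn).additive P hPm a _ (hPm a) _ (hPm a),
      Function.update_eq_self, ih, Finset.card_insert_of_notMem ha]
    ring

/-- Doubling the coordinates in `J` turns the sets indexed by `I` into twice the standard one and
makes the other ones smaller. -/
lemma two_pow_le_relMixedVolume (hn : 0 < n) (I J : Finset (Fin n)) :
    (2 : ℝ) ^ I.card ≤ 2 ^ J.card * relMixedVolume (fun i : Fin n =>
      (orthant n, cutOrthant (if i ∈ I then halfWeight J else 1) 1)) := by
  set a : Fin n → ℝ := fun j => if j ∈ J then 2 else 1 with ha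
  have hapos : ∀ j, 0 < a j := by
    intro j
    simp only [ha]
    split_ifs <;> norm_num
  have hdet : LinearMap.det (Matrix.toLin' (Matrix.diagonal a)) = 2 ^ J.card := by
    rw [LinearMap.det_toLin', Matrix.det_diagonal]
    simp [ha]
  have hinj : Function.Injective (Matrix.toLin' (Matrix.diagonal a)) := by
    intro x y hxy
    ext i
    have := congrFun hxy i
    simp only [Matrix.toLin'_apply, Matrix.mulVec_diagonal] at this
    exact mul_left_cancel₀ (hapos i).ne' this
  have h1 := relMixedVolume_image_linearMap _ hinj (fun i : Fin n =>
      (orthant n, cutOrthant (if i ∈ I then halfWeight J else 1) 1))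
  rw [hdet, abs_of_pos (by positivity)] at h1
  rw [← h1, ← relMixedVolume_double hn I]
  simp only [image_diagonal_orthant hapos, image_diagonal_cutOrthant hapos]
  have hpos1 : ∀ i k : Fin n,
      0 < (if i ∈ I then (fun _ => 1 / 2) else 1 : Fin n → ℝ) k := by
    intro i k
    split_ifs <;> norm_num
  have hpos2 : ∀ i k : Fin n, 0 < (if i ∈ I then halfWeight J else 1) k / a k := by
    intro i k
    refine div_pos ?_ (hapos k)
    split_ifs
    · exact halfWeight_pos J k
    · exact one_pos
  refine relMixedVolume_anti_orthant hn (fun i => cutOrthant_mem_orthantPairs (hpos2 i) 1)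
    (fun i => cutOrthant_mem_orthantPairs (hpos1 i) 1) fun i => ?_
  rintro x ⟨hx, hx1⟩
  have hx2 : (1 : ℝ) ≤ (fun k => (if i ∈ I then halfWeight J else 1) k / a k) ⬝ᵥ x := hx1
  refine ⟨hx, show (1 : ℝ) ≤ (if i ∈ I then (fun _ => 1 / 2) else 1 : Fin n → ℝ) ⬝ᵥ x from
    hx2.trans (Finset.sum_le_sum fun k _ => ?_)⟩
  refine mul_le_mul_of_nonneg_right ?_ (hx k)
  by_cases hi : i ∈ I <;> by_cases hk : k ∈ J <;> simp [hi, hk, ha, halfWeight] <;> norm_num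

/-! ### Lattice points and the classification -/

lemma one_le_sum_of_integral {v : Fin n → ℝ} (hv : v ∈ orthant n) (hv0 : v ≠ 0)
    {z : Fin n → ℤ} (hz : ∀ i, v i = z i) : 1 ≤ (1 : Fin n → ℝ) ⬝ᵥ v := by
  obtain ⟨k, hk⟩ := Function.ne_iff.1 hv0
  have h1 : 1 ≤ v k := by
    have h2 := hv k
    rw [hz k] at h2 hk ⊢
    simp only [Pi.zero_apply, ne_eq, Int.cast_eq_zero] at hk
    have h3 : 0 ≤ z k := by exact_mod_cast h2
    exact_mod_cast (show 1 ≤ z k by omega)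
  rw [one_dotProduct]
  exact h1.trans (Finset.single_le_sum (f := v) (fun i _ => hv i) (Finset.mem_univ k))

lemma one_le_halfWeight_of_integral {J : Finset (Fin n)} {v : Fin n → ℝ} (hv : v ∈ orthant n)
    (hv0 : v ≠ 0) {z : Fin n → ℤ} (hz : ∀ i, v i = z i)
    (hJ : ∀ k, k ∉ J → v ≠ Pi.single k 1) : 1 ≤ halfWeight J ⬝ᵥ v := by
  have hnn : ∀ i, 0 ≤ halfWeight J i * v i := fun i => mul_nonneg (halfWeight_pos J i).le (hv i)
  have hint : ∀ i, v i ≠ 0 → 1 ≤ v i := by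
    intro i hi
    have h2 := hv i
    rw [hz i] at h2 hi ⊢
    have h4 : z i ≠ 0 := by exact_mod_cast hi
    have h3 : 0 ≤ z i := by exact_mod_cast h2
    exact_mod_cast (show 1 ≤ z i by omega)
  obtain ⟨k, hk⟩ := Function.ne_iff.1 hv0
  have hk1 := hint k hk
  by_cases hkJ : k ∈ J
  · refine le_trans ?_ (Finset.single_le_sum (f := fun i => halfWeight J i * v i)
      (fun i _ => hnn i) (Finset.mem_univ k))
    simpa [halfWeight, hkJ] using hk1
  · by_cases hk2 : v k = 1
    · -- as `v` is not `e_k`, another coordinate is positive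
      obtain ⟨l, hl⟩ := Function.ne_iff.1 (hJ k hkJ)
      have hlk : l ≠ k := by
        rintro rfl
        simp [hk2] at hl
      rw [Pi.single_eq_of_ne hlk] at hl
      have h1 : halfWeight J k * v k + halfWeight J l * v l ≤ halfWeight J ⬝ᵥ v := by
        rw [← Finset.sum_pair (f := fun i => halfWeight J i * v i) hlk.symm]
        exact Finset.sum_le_sum_of_subset_of_nonneg (Finset.subset_univ _) fun i _ _ => hnn i
      have h2 : 1 / 2 ≤ halfWeight J l * v l := by
        have h3 : 1 / 2 ≤ halfWeight J l := by
          unfold halfWeight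
          split_ifs <;> norm_num
        nlinarith [hint l hl]
      have h4 : halfWeight J k = 1 / 2 := by simp [halfWeight, hkJ]
      rw [h4, hk2] at h1
      linarith
    · have h1 : 2 ≤ v k := by
        rw [hz k] at hk1 hk2 ⊢
        have h2 : 1 ≤ z k := by exact_mod_cast hk1
        have h3 : z k ≠ 1 := by exact_mod_cast hk2
        exact_mod_cast (show 2 ≤ z k by omega)
      refine le_trans ?_ (Finset.single_le_sum (f := fun i => halfWeight J i * v i)
        (fun i _ => hnn i) (Finset.mem_univ k))
      simp only [halfWeight, hkJ, if_false]
      linarith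

lemma relMixedVolume_eq_one_iff (hn : 0 < n) {B : Fin n → Set (Fin n → ℝ)}
    (hB : ∀ i, IsLatticePolyhedron (B i))
    (hbdd : ∀ i, Bornology.IsBounded (symmDiff (orthant n) (B i))) :
    relMixedVolume (fun i => (orthant n, B i)) = 1 ↔
      (∀ i, (0 : Fin n → ℝ) ∉ B i) ∧
        ∃ σ τ : Equiv.Perm (Fin n), ∀ m, (Pi.single (τ m) 1 : Fin n → ℝ) ∈ B (σ m) := by
  classical
  have hBm : ∀ i, (orthant n, B i) ∈ orthantPairs n := fun i => orthant_mk_mem (hB i).1 (hbdd i)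
  constructor
  · intro h1
    have h0 : ∀ i, (0 : Fin n → ℝ) ∉ B i := by
      intro i hi
      -- replacing `B i` by the orthant makes it smaller and the mixed volume zero
      have hsub : orthant n ⊆ B i := fun x hx =>
        isUpperSet_of_isBounded_symmDiff (hB i).1 (hbdd i) hx hi
      have hupd : (fun j => (orthant n, Function.update B i (orthant n) j)) =
          Function.update (fun j => (orthant n, B j)) i (orthant n, orthant n) := by
        ext1 j
        by_cases hj : j = i
        · subst hj; simp
        · simp [hj]
      have hzero := (isMixedVolume_relMixedVolume hn).additive _ hBm i _ orthant_pair_mem _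
        orthant_pair_mem
      rw [Prod.mk_add_mk, orthant_add_of_isUpperSet isUpperSet_orthant] at hzero
      have hle := relMixedVolume_anti_orthant hn (B := Function.update B i (orthant n)) (B' := B)
        (fun j => by
          by_cases hj : j = i
          · subst hj; simpa using orthant_pair_mem
          · simpa [hj] using hBm j) hBm (fun j => by
          by_cases hj : j = i
          · subst hj; simpa using hsub
          · simp [hj])
      rw [hupd] at hle
      linarith
    refine ⟨h0, ?_⟩
    set t : Fin n → Finset (Fin n) := fun i =>
      Finset.univ.filter fun j => (Pi.single j 1 : Fin n → ℝ) ∈ B i with ht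
    by_cases hall : ∀ I : Finset (Fin n), I.card ≤ (I.biUnion t).card
    · obtain ⟨f, hf, hft⟩ := (Finset.all_card_le_biUnion_card_iff_exists_injective t).1 hall
      refine ⟨Equiv.refl _, Equiv.ofBijective f (Finite.injective_iff_bijective.1 hf), fun m => ?_⟩
      simpa [ht] using hft m
    · exfalso
      push Not at hall
      obtain ⟨I, hI⟩ := hall
      set J := I.biUnion t with hJ
      have hw : ∀ i k, 0 < (if i ∈ I then halfWeight J else 1) k := by
        intro i k
        split_ifs
        · exact halfWeight_pos J k
        · exact one_pos
      have hsub : ∀ i, B i ⊆ cutOrthant (if i ∈ I then halfWeight J else 1) 1 := by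
        intro i
        have hC := subset_orthant_of_zero_notMem (hB i).1 (hbdd i) (h0 i)
        refine subset_cutOrthant_of_extremePoints (hB i).1 hC (hw i) fun v hv => ?_
        have hvB : v ∈ B i := extremePoints_subset hv
        have hv0 : v ≠ 0 := fun hc => h0 i (hc ▸ hvB)
        obtain ⟨z, hz⟩ := (hB i).2 v hv
        split_ifs with hi
        · refine one_le_halfWeight_of_integral (hC hvB) hv0 hz fun k hk hvk => hk ?_
          exact Finset.mem_biUnion.2 ⟨i, hi, by simpa [ht] using hvk ▸ hvB⟩
        · exact one_le_sum_of_integral (hC hvB) hv0 hz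
      have h2 := relMixedVolume_anti_orthant hn hBm
        (fun i => cutOrthant_mem_orthantPairs (hw i) 1) hsub
      have h3 := two_pow_le_relMixedVolume hn I J
      rw [h1] at h2
      have h4 : (2 : ℝ) ^ I.card ≤ 2 ^ J.card :=
        h3.trans (mul_le_of_le_one_right (by positivity) h2)
      exact absurd ((pow_le_pow_iff_right₀ one_lt_two).1 h4) (not_le.2 hI)
  · rintro ⟨h0, σ, τ, hστ⟩
    refine le_antisymm ?_ ?_
    · have hev : ∀ᶠ ε : ℝ in 𝓝[>] 0, ∀ m, cutOrthant (spike ε (τ m)) 1 ⊆ B (σ m) :=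
        eventually_all.2 fun m =>
          eventually_cutOrthant_spike_subset (hB (σ m)).1 (hbdd (σ m)) (hστ m)
      obtain ⟨ε, hε, hε0, hε1⟩ := (hev.and (Ioo_mem_nhdsGT (zero_lt_one' ℝ))).exists
      obtain ⟨m, rfl⟩ := Nat.exists_eq_succ_of_ne_zero hn.ne'
      rw [← relMixedVolume_spike hε0 hε1.le m,
        ← relMixedVolume_comp_perm (fun i => (orthant (m + 1), B i)) σ,
        ← relMixedVolume_comp_perm (fun i => (orthant (m + 1), cutOrthant (spike ε i) 1)) τ]
      exact relMixedVolume_anti_orthant hn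
        (fun i => cutOrthant_mem_orthantPairs (spike_pos hε0 _) 1) (fun i => hBm (σ i)) hε
    · rw [← relMixedVolume_simplex hn]
      refine relMixedVolume_anti_orthant hn hBm
        (fun i => cutOrthant_mem_orthantPairs (fun _ => one_pos) 1) fun i => ?_
      have hC := subset_orthant_of_zero_notMem (hB i).1 (hbdd i) (h0 i)
      refine subset_cutOrthant_of_extremePoints (hB i).1 hC (fun _ => one_pos) fun v hv => ?_
      have hvB : v ∈ B i := extremePoints_subset hv
      obtain ⟨z, hz⟩ := (hB i).2 v hv
      exact one_le_sum_of_integral (hC hvB) (fun hc => h0 i (hc ▸ hvB)) hz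

end RelativeMixedVolume

theorem theorem3p1 (n : ℕ) (hn : 1 ≤ n) (B : Fin n → Set (Fin n → ℝ))
    (hB : ∀ i, RelativeMixedVolume.IsLatticePolyhedron (B i))
    (hbdd : ∀ i, Bornology.IsBounded (symmDiff (RelativeMixedVolume.orthant n) (B i))) :
    -- the pairs `(C, B i)` lie in the domain of the mixed volume
    (∀ i, (RelativeMixedVolume.orthant n, B i) ∈ RelativeMixedVolume.polyhedronPairs
      (RelativeMixedVolume.supportCone (RelativeMixedVolume.orthant n))) ∧
    -- the mixed volume exists
    ∃ MV : (Fin n → Set (Fin n → ℝ) × Set (Fin n → ℝ)) → ℝ,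
      RelativeMixedVolume.IsMixedVolume
        (RelativeMixedVolume.supportCone (RelativeMixedVolume.orthant n)) MV ∧
      -- it is unique on its domain
      (∀ MV' : (Fin n → Set (Fin n → ℝ) × Set (Fin n → ℝ)) → ℝ,
        RelativeMixedVolume.IsMixedVolume
          (RelativeMixedVolume.supportCone (RelativeMixedVolume.orthant n)) MV' →
        ∀ P : Fin n → Set (Fin n → ℝ) × Set (Fin n → ℝ),
          (∀ i, P i ∈ RelativeMixedVolume.polyhedronPairs
            (RelativeMixedVolume.supportCone (RelativeMixedVolume.orthant n))) →
          MV' P = MV P) ∧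
      -- the classification of the tuples of mixed volume one
      (MV (fun i => (RelativeMixedVolume.orthant n, B i)) = 1 ↔
        (∀ i, (0 : Fin n → ℝ) ∉ B i) ∧
        ∃ σ τ : Equiv.Perm (Fin n), ∀ m, (Pi.single (τ m) 1 : Fin n → ℝ) ∈ B (σ m)) := by
  have h : ∀ i, (RelativeMixedVolume.orthant n, B i) ∈ RelativeMixedVolume.orthantPairs n :=
    fun i => RelativeMixedVolume.orthant_mk_mem (hB i).1 (hbdd i)
  have hMV := RelativeMixedVolume.isMixedVolume_relMixedVolume hn
  refine ⟨h, RelativeMixedVolume.relMixedVolume, hMV, fun MV' hMV' P hP => ?_,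
    RelativeMixedVolume.relMixedVolume_eq_one_iff hn hB hbdd⟩
  have h1 := hMV.altSum_pairVolume hn RelativeMixedVolume.orthant_pair_mem P hP
  rw [hMV'.altSum_pairVolume hn RelativeMixedVolume.orthant_pair_mem P hP] at h1
  exact mul_left_cancel₀ (by exact_mod_cast n.factorial_ne_zero) h1
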